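/- Let $-\infty<a<b<\infty$ and let $f$ be a probability density on $\mathbb R$ which vanishes outside $(a,b)$, is positive and $C^1$ on $(a,b)$, and satisfies, for some $A_1,A_2>0$, $$f(x)\sim A_1(x-a)\quad(x\to a+0),\qquad f(x)\sim A_2(b-x)\quad(x\to b-0)$$ (the case $\kappa_1=\kappa_2=2$ of the edge behaviour $f(x)\sim A_1(x-a)^{\kappa_1-1}$, $f(x)\sim A_2(b-x)^{\kappa_2-1}$). Consider the location shift family $f_\theta(x)=f(x-\theta)$, $\theta\in\mathbb R$, and let $f_\theta^n$ be the law of $n$ i.i.d. observations with density $f_\theta$. An estimator is a sequence $\vec T=\{T_n\}$ of measurable functions $T_n:\mathbb R^n\to\mathbb R$. Put $g(x)=-x^2\log x$ and define, in $[0,\infty]$, $$\beta(\vec T,\theta,\epsilon)=\liminf_{n\to\infty}\frac{-1}{n}\log f_\theta^n\{|T_n-\theta|\ge\epsilon\},$$ $$\alpha_1(\theta)=\limsup_{\epsilon\to+0}\frac1{g(\epsilon)}\sup_{\vec T}\inf_{\theta-\epsilon\le\theta'\le\theta+\epsilon}\beta(\vec T,\theta',\epsilon),$$ $$\alpha_2(\vec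 T,\theta)=\liminf_{\epsilon\to+0}\frac1{g(\epsilon)}\inf_{\theta-\epsilon\le\theta'\le\theta+\epsilon}\beta(\vec T,\theta',\epsilon),\qquad \alpha_2(\theta)=\sup_{\vec T}\alpha_2(\vec T,\theta).$$ With $I^s(p\|q)=-\log\int p^s q^{1-s}\,dx$, let $$I^s_{g,\theta}=\lim_{\epsilon\to+0}\frac{I^s(f_{\theta-\epsilon/2}\|f_{\theta+\epsilon/2})}{g(\epsilon)}\quad(0<s<1),\qquad x^\kappa=\lim_{\epsilon\to+0}\frac{g(x\epsilon)}{g(\epsilon)}\quad(x>0),$$ $$\overline\alpha_1(\theta)=2^\kappa\sup_{0<s<1}I^s_{g,\theta},$$ and let $\overline\alpha_2(\theta)$ be $$\sup_{0<s<1}\frac{I^s_{g,\theta}}{s(1-s)}\bigl(s^{\frac1{\kappa-1}}+(1-s)^{\frac1{\kappa-1}}\bigr)^{\kappa-1}\ (\kappa<1),\qquad 2I^{1/2}_{g,\theta}\ (\kappa=1),\qquad \inf_{0<s<1}\frac{I^s_{g,\theta}}{s(1-s)}\bigl(s^{\frac1{\kappa-1}}+(1-s)^{\frac1{\kappa-1}}\bigr)^{\kappa-1}\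 (\kappa>1).$$ Suppose that $x\mapsto\log f(x)$ is concave on $(a,b)$. Then, for every $\theta\in\mathbb R$: the limit defining $\kappa$ exists for every $x>0$, with $\kappa=2$; the limit defining $I^s_{g,\theta}$ exists uniformly in $0<s<1$; and $$\alpha_1(\theta)=\overline\alpha_1(\theta)=\alpha_2(\theta)=\overline\alpha_2(\theta)=\frac{A_1+A_2}{2}.$$ Moreover, a maximum likelihood estimator (an estimator for which $T_n(x_1,\dots,x_n)$ maximizes $\theta\mapsto\prod_{i=1}^n f(x_i-\theta)$ for all data) exists, and every maximum likelihood estimator $\vec\theta_{ML}$ satisfies $\alpha_2(\vec\theta_{ML},\theta)=\frac{A_1+A_2}{2}$. -/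

import Mathlib

open Set Filter Topology MeasureTheory
open scoped ENNReal

noncomputable section

namespace LargeDeviation

/-- The relative Rényi entropy `I^s(p‖q) = -log ∫ p^s q^(1-s)` of two densities on `ℝ`
(it is `+∞` when the integral vanishes). -/
def renyi (s : ℝ) (p q : ℝ → ℝ) : EReal :=
  -ENNReal.log (∫⁻ x, ENNReal.ofReal (p x ^ s * q x ^ (1 - s)))

/-- The law of `n` i.i.d. observations with density `q`. -/
def iidLaw (q : ℝ → ℝ) (n : ℕ) : Measure (Fin n → ℝ) :=
  Measure.pi fun _ => (volume : Measure ℝ).withDensity fun x => ENNReal.ofReal (q x)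

/-- An estimator: for each sample size `n`, a measurable real function of the data. -/
structure Estimator where
  est : (n : ℕ) → (Fin n → ℝ) → ℝ
  measurable_est : ∀ n, Measurable (est n)

variable (p : ℝ → ℝ → ℝ) (g : ℝ → ℝ)

/-- First exponential rate `liminf_n -(1/n) log p_θ^n {|T_n - θ| ≥ ε}` of an estimator,
with values in `[0, ∞]`. -/
def firstRate (T : Estimator) (θ ε : ℝ) : EReal :=
  liminf (fun n : ℕ => -ENNReal.log (iidLaw (p θ) n {x | ε ≤ |T.est n x - θ|}) / (n : EReal))
    atTop

/-- `inf_{θ-ε ≤ θ' ≤ θ+ε} β(T, θ', ε)`. -/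
def localRate (T : Estimator) (θ ε : ℝ) : EReal :=
  ⨅ θ' ∈ Icc (θ - ε) (θ + ε), firstRate p T θ' ε

/-- `α₁(θ)`: the limit of the bound for interval estimation. -/
def alpha1 (θ : ℝ) : EReal :=
  limsup (fun ε : ℝ => (⨆ T : Estimator, localRate p T θ ε) / (g ε : EReal)) (𝓝[>] 0)

/-- `α₂(T, θ)`: the second exponential rate of the estimator `T`. -/
def alpha2Of (T : Estimator) (θ : ℝ) : EReal :=
  liminf (fun ε : ℝ => localRate p T θ ε / (g ε : EReal)) (𝓝[>] 0)

/-- `α₂(θ)`: the bound for point estimation. -/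
def alpha2 (θ : ℝ) : EReal :=
  ⨆ T : Estimator, alpha2Of p g T θ

/-- `I^s(p_{θ-ε/2} ‖ p_{θ+ε/2}) / g(ε)`. -/
def renyiQuotient (θ s ε : ℝ) : EReal :=
  renyi s (p (θ - ε / 2)) (p (θ + ε / 2)) / (g ε : EReal)

/-- `I^s_{g,θ}`, the limit of the normalized Rényi entropies as `ε → +0`. -/
def renyiLimit (θ s : ℝ) : EReal :=
  limUnder (𝓝[>] 0) (renyiQuotient p g θ s)

/-- The limit defining `I^s_{g,θ}` exists, uniformly for `0 < s < 1`. -/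
def RenyiConvergesUniformly (θ : ℝ) : Prop :=
  ∀ δ : ℝ, 0 < δ → ∀ᶠ ε in 𝓝[>] (0 : ℝ), ∀ s ∈ Ioo (0 : ℝ) 1,
    renyiLimit p g θ s - (δ : EReal) ≤ renyiQuotient p g θ s ε ∧
      renyiQuotient p g θ s ε ≤ renyiLimit p g θ s + (δ : EReal)

/-- `κ > 0` is the exponent with `x^κ = lim_{ε → +0} g(xε)/g(ε)` for all `x > 0`. -/
def IsScalingExponent (κ : ℝ) : Prop :=
  0 < κ ∧ ∀ x : ℝ, 0 < x → Tendsto (fun ε => g (x * ε) / g ε) (𝓝[>] 0) (𝓝 (x ^ κ))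

/-- The upper bound `2^κ sup_{0<s<1} I^s_{g,θ}` of `α₁(θ)`. -/
def alphaBar1 (κ θ : ℝ) : EReal :=
  (((2 : ℝ) ^ κ : ℝ) : EReal) * ⨆ s ∈ Ioo (0 : ℝ) 1, renyiLimit p g θ s

/-- The weight `(s^(1/(κ-1)) + (1-s)^(1/(κ-1)))^(κ-1) / (s(1-s))`. -/
def weight (κ s : ℝ) : ℝ :=
  (s ^ (1 / (κ - 1)) + (1 - s) ^ (1 / (κ - 1))) ^ (κ - 1) / (s * (1 - s))

open Classical in
/-- The upper bound of `α₂(θ)`. -/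
def alphaBar2 (κ θ : ℝ) : EReal :=
  if κ < 1 then ⨆ s ∈ Ioo (0 : ℝ) 1, (weight κ s : EReal) * renyiLimit p g θ s
  else if κ = 1 then 2 * renyiLimit p g θ (1 / 2)
  else ⨅ s ∈ Ioo (0 : ℝ) 1, (weight κ s : EReal) * renyiLimit p g θ s

/-- `T` is a maximum likelihood estimator: `T_n(x)` maximizes `θ ↦ ∏ p_θ(x_i)`. -/
def IsMLE (T : Estimator) : Prop :=
  ∀ (n : ℕ) (x : Fin n → ℝ) (θ : ℝ), ∏ i, p θ (x i) ≤ ∏ i, p (T.est n x) (x i)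

/-- The location shift family generated by `f`. -/
def shiftFamily (f : ℝ → ℝ) (θ x : ℝ) : ℝ := f (x - θ)

/-- `f` is a probability density, positive exactly on the bounded interval `(a, b)` and `C¹` there,
with `f(x) ∼ A₁ (x-a)^(κ₁-1)` as `x → a+0` and `f(x) ∼ A₂ (b-x)^(κ₂-1)` as `x → b-0`. -/
structure IsIntervalDensity (f : ℝ → ℝ) (a b κ₁ κ₂ A₁ A₂ : ℝ) : Prop where
  lt : a < b
  pos : ∀ x ∈ Ioo a b, 0 < f x
  zero : ∀ x, x ∉ Ioo a b → f x = 0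
  integral_eq_one : ∫⁻ x, ENNReal.ofReal (f x) = 1
  contDiffOn : ContDiffOn ℝ 1 f (Ioo a b)
  kappa_pos : 0 < κ₁ ∧ 0 < κ₂
  coeff_pos : 0 < A₁ ∧ 0 < A₂
  left_edge : Asymptotics.IsEquivalent (𝓝[>] a) f fun x => A₁ * (x - a) ^ (κ₁ - 1)
  right_edge : Asymptotics.IsEquivalent (𝓝[<] b) f fun x => A₂ * (b - x) ^ (κ₂ - 1)

/-- The normalization `g(x) = -x² log x`. -/
def gLog (x : ℝ) : ℝ := -(x ^ 2 * Real.log x)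

end LargeDeviation

end

/-! Write l = log f, c = (A₁+A₂)/2 and g = `gLog`. Everything is decided at the two edges. At
distance y from an edge, f is close to A y, and concavity of l upgrades this to |l'| ~ 1/y. A shift
by h therefore changes l by about ±h/y, and the second-order terms have density about A h²/y.
Integrated from y of order |h| up to a constant this gives A h² log(1/|h|), that is A g(|h|), while
terms of order h² are negligible against g. Two expansions as |h| = ε → 0 follow: ∫ f(y+h)^s
f(y)^(1-s) dy = 1 - s(1-s) c g(ε) + o(g(ε)) for h = ε, uniformly in s, and ∫ f(y+h) exp(-h l'(y)) dy
≤ 1 - c g(ε) + o(g(ε)) for both signs of h.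

The first expansion gives the Rényi limits s(1-s)c, hence both closed-form bounds. It also gives the
converse: an estimator accurate to ε at θ-ε and at θ+ε would test these two parameters, and the
error exponent of such a test is at most about I^{1/2} at distance 2ε, which is (c/4) g(2ε) ~ c g(ε)
(`min_firstRate_le`, `alpha1_le`).

The second expansion gives achievability. If a maximum likelihood estimate lies at or beyond θ+h, on
the far side from θ, then by concavity h ∑ l'(x_i-θ-h) ≤ 0, and Chernoff's bound with the tilt h
produces exactly the integral above (`iidLaw_isMLE_le`, `le_alpha2Of`).

Since α₂(T) ≤ α₁ for each T, the chain c ≤ α₂(ML) ≤ α₂ ≤ α₁ ≤ c closes. A measurable choice of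
maximizer provides a maximum likelihood estimator. -/

noncomputable section

namespace LargeDeviation

/-! ### Log-concave functions near a linear zero -/

/-- A positive `C¹` log-concave function on `(0, L)` with `φ(y) ∼ A y` as `y → +0`. -/
structure EdgeProfile (φ : ℝ → ℝ) (L A : ℝ) : Prop where
  length_pos : 0 < L
  coeff_pos : 0 < A
  pos : ∀ y ∈ Ioo 0 L, 0 < φ y
  zero : ∀ y ≤ 0, φ y = 0
  contDiffOn : ContDiffOn ℝ 1 φ (Ioo 0 L)
  concave : ConcaveOn ℝ (Ioo 0 L) fun y => Real.log (φ y)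
  edge : Tendsto (fun y => φ y / y) (𝓝[>] 0) (𝓝 A)

/-- The tangent line of a concave function lies above its graph. -/
theorem ConcaveOn.le_tangent {S : Set ℝ} {l : ℝ → ℝ} (hl : ConcaveOn ℝ S l) {x y d : ℝ}
    (hx : x ∈ S) (hy : y ∈ S) (hd : HasDerivAt l d x) : l y ≤ l x + (y - x) * d := by
  rcases lt_trichotomy x y with h | h | h
  · have := hl.slope_le_of_hasDerivAt hx hy h hd
    rw [slope_def_field, div_le_iff₀ (by linarith)] at this
    linarith
  · simp [h]
  · have := hl.le_slope_of_hasDerivAt hy hx h hd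
    rw [slope_def_field, le_div_iff₀ (by linarith)] at this
    linarith

theorem tendsto_log_one_add_div : Tendsto (fun k : ℝ => Real.log (1 + k) / k) (𝓝[≠] 0) (𝓝 1) := by
  have h : HasDerivAt (fun k : ℝ => Real.log (1 + k)) 1 0 := by
    have := ((hasDerivAt_id (0 : ℝ)).const_add 1).log (by simp)
    simpa using this
  have := h.tendsto_slope
  refine this.congr fun k => ?_
  simp [slope_def_field]

namespace EdgeProfile

variable {φ : ℝ → ℝ} {L A : ℝ}

theorem differentiableAt (hφ : EdgeProfile φ L A) {y : ℝ} (hy : y ∈ Ioo 0 L) :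
    DifferentiableAt ℝ φ y :=
  (hφ.contDiffOn.differentiableOn (by norm_num)).differentiableAt (isOpen_Ioo.mem_nhds hy)

theorem hasDerivAt_log (hφ : EdgeProfile φ L A) {y : ℝ} (hy : y ∈ Ioo 0 L) :
    HasDerivAt (fun y => Real.log (φ y)) (deriv φ y / φ y) y :=
  (hφ.differentiableAt hy).hasDerivAt.log (hφ.pos y hy).ne'

theorem log_le_tangent (hφ : EdgeProfile φ L A) {x y : ℝ} (hx : x ∈ Ioo 0 L) (hy : y ∈ Ioo 0 L) :
    Real.log (φ y) ≤ Real.log (φ x) + (y - x) * (deriv φ x / φ x) :=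
  ConcaveOn.le_tangent hφ.concave hx hy (hφ.hasDerivAt_log hx)

theorem tendsto_log_sub (hφ : EdgeProfile φ L A) {k : ℝ} (hk : -1 < k) :
    Tendsto (fun y => Real.log (φ (y * (1 + k))) - Real.log (φ y)) (𝓝[>] 0)
      (𝓝 (Real.log (1 + k))) := by
  have hk' : 0 < 1 + k := by linarith
  have h1 : Tendsto (fun y : ℝ => y * (1 + k)) (𝓝[>] 0) (𝓝[>] 0) := by
    refine tendsto_nhdsWithin_iff.2 ⟨?_, ?_⟩
    · have : Tendsto (fun y : ℝ => y * (1 + k)) (𝓝 0) (𝓝 (0 * (1 + k))) :=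
        (continuous_id.mul continuous_const).tendsto 0
      rw [zero_mul] at this
      exact this.mono_left nhdsWithin_le_nhds
    · filter_upwards [self_mem_nhdsWithin] with y hy
      exact mul_pos hy hk'
  have h2 := (hφ.edge.log hφ.coeff_pos.ne')
  have h3 := ((h2.comp h1).sub h2).add_const (Real.log (1 + k))
  rw [sub_self, zero_add] at h3
  refine h3.congr' ?_
  have hL : ∀ᶠ y : ℝ in 𝓝[>] 0, y ∈ Ioo 0 L := Ioo_mem_nhdsGT hφ.length_pos
  filter_upwards [hL, h1.eventually hL] with y hy hy'
  have hp := hφ.pos _ hy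
  have hp' := hφ.pos _ hy'
  simp only [Function.comp]
  rw [Real.log_div hp.ne' hy.1.ne', Real.log_div hp'.ne' hy'.1.ne',
    Real.log_mul hy.1.ne' hk'.ne']
  ring

/-- Asymptotics cannot be differentiated in general, but concavity permits it here: the tangent at y
bounds the increment log φ(y(1+k)) - log φ(y), which tends to log(1+k), and log(1+k)/k is close to 1
for small k. Positive k bounds the limit from below, negative k from above. -/
theorem tendsto_mul_logDeriv (hφ : EdgeProfile φ L A) :
    Tendsto (fun y => y * (deriv φ y / φ y)) (𝓝[>] 0) (𝓝 1) := by
  have key : ∀ k : ℝ, -1 < k → ∀ᶠ y : ℝ in 𝓝[>] 0,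
      Real.log (φ (y * (1 + k))) - Real.log (φ y) ≤ k * (y * (deriv φ y / φ y)) := by
    intro k hk
    have h1 : ∀ᶠ y : ℝ in 𝓝[>] 0, y ∈ Ioo 0 L := Ioo_mem_nhdsGT hφ.length_pos
    have h2 : ∀ᶠ y : ℝ in 𝓝[>] 0, y ∈ Ioo 0 (L / (1 + k)) :=
      Ioo_mem_nhdsGT (div_pos hφ.length_pos (by linarith))
    filter_upwards [h1, h2] with y hy hy'
    have := hφ.log_le_tangent hy (y := y * (1 + k))
      ⟨mul_pos hy.1 (by linarith), (lt_div_iff₀ (by linarith)).1 hy'.2⟩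
    linarith
  rw [tendsto_order]
  constructor
  · intro r hr
    have h0 : ∀ᶠ k : ℝ in 𝓝[>] 0, r < Real.log (1 + k) / k :=
      (tendsto_log_one_add_div.mono_left (nhdsWithin_mono _ fun x hx => ne_of_gt hx)).eventually_const_lt hr
    obtain ⟨k, hk, hk0⟩ := (h0.and self_mem_nhdsWithin).exists
    have hk0 : 0 < k := hk0
    have h2 : r * k < Real.log (1 + k) := (lt_div_iff₀ hk0).1 hk
    filter_upwards [key k (by linarith), (hφ.tendsto_log_sub (k := k) (by linarith)).eventually_const_lt h2]
      with y h3 h4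
    have : k * r < k * (y * (deriv φ y / φ y)) := by linarith
    exact lt_of_mul_lt_mul_left this hk0.le
  · intro r hr
    have h0 : ∀ᶠ k : ℝ in 𝓝[<] 0, Real.log (1 + k) / k < r :=
      (tendsto_log_one_add_div.mono_left (nhdsWithin_mono _ fun x hx => ne_of_lt hx)).eventually_lt_const hr
    have h1 : ∀ᶠ k : ℝ in 𝓝[<] 0, k ∈ Ioo (-1) 0 := Ioo_mem_nhdsLT (by norm_num)
    obtain ⟨k, hk, hk0⟩ := (h0.and h1).exists
    have h2 : r * k < Real.log (1 + k) := (div_lt_iff_of_neg hk0.2).1 hk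
    filter_upwards [key k hk0.1, (hφ.tendsto_log_sub (k := k) hk0.1).eventually_const_lt h2]
      with y h3 h4
    have : k * r < k * (y * (deriv φ y / φ y)) := by linarith
    exact (mul_lt_mul_left_of_neg hk0.2).1 this

/-- The first-order behaviour of `φ`, of `(log φ)'` and of the increments of `log φ` at the edge. -/
theorem exists_edge_bound (hφ : EdgeProfile φ L A) {δ : ℝ} (hδ : 0 < δ) (hδ' : δ ≤ 1 / 10) :
    ∃ η, 0 < η ∧ η < L / 2 ∧ ∀ y, 0 < y → y ≤ η →
      |φ y - A * y| ≤ δ * (A * y) ∧ |y * (deriv φ y / φ y) - 1| ≤ δ ∧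
      ∀ h, |h| ≤ δ * y → |Real.log (φ (y + h)) - Real.log (φ y) - h / y| ≤ 4 * δ * (|h| / y) := by
  have h1 : ∀ᶠ y : ℝ in 𝓝[>] 0, |φ y / y - A| < δ * A := by
    have := (Metric.tendsto_nhds.1 hφ.edge) (δ * A) (mul_pos hδ hφ.coeff_pos)
    simpa [Real.dist_eq] using this
  have h2 : ∀ᶠ y : ℝ in 𝓝[>] 0, |y * (deriv φ y / φ y) - 1| < δ := by
    have := (Metric.tendsto_nhds.1 hφ.tendsto_mul_logDeriv) δ hδ
    simpa [Real.dist_eq] using this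
  obtain ⟨r, hr, hr'⟩ := mem_nhdsGT_iff_exists_Ioo_subset.1 (h1.and h2)
  have hr0 : 0 < r := hr
  -- The factor 4 keeps y + h < 2y inside both (0, r) and (0, L).
  refine ⟨min r L / 4, by have := lt_min hr0 hφ.length_pos; linarith,
    by have := min_le_right r L; linarith [hφ.length_pos], fun y hy hyη => ?_⟩
  have hmr := min_le_left r L
  have hmL := min_le_right r L
  have hyr := hr' (show y ∈ Ioo 0 r from ⟨hy, by linarith⟩)
  refine ⟨?_, hyr.2.le, fun h hh => ?_⟩
  · have : φ y - A * y = (φ y / y - A) * y := by field_simp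
    rw [this, abs_mul, abs_of_pos hy, ← mul_assoc]
    exact mul_le_mul_of_nonneg_right hyr.1.le hy.le
  · have hh' := abs_le.1 hh
    have hy1 : 0 < y + h := by nlinarith
    have hy2 : y + h < 2 * y := by nlinarith
    have hyr' : |(y + h) * (deriv φ (y + h) / φ (y + h)) - 1| < δ := (hr' (show y + h ∈ Ioo 0 r from ⟨hy1, by linarith⟩)).2
    have hyL : y ∈ Ioo 0 L := ⟨hy, by linarith⟩
    have hyL' : y + h ∈ Ioo 0 L := ⟨hy1, by linarith⟩
    have t1 := hφ.log_le_tangent hyL hyL'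
    have t2 := hφ.log_le_tangent hyL' hyL
    have e1 := hyr.2
    generalize deriv φ y / φ y = v at *
    generalize deriv φ (y + h) / φ (y + h) = w at *
    rw [show y + h - y = h by ring] at t1
    rw [show y - (y + h) = -h by ring] at t2
    -- By concavity the increment lies between h times the slopes at the two ends, so it suffices
    -- that both slopes are within 4δ/y of 1/y.
    have hv : |v - 1 / y| ≤ 4 * δ / y := by
      rw [show v - 1 / y = (y * v - 1) / y by field_simp, abs_div, abs_of_pos hy]
      gcongr; linarith
    have hw : |w - 1 / y| ≤ 4 * δ / y := by
      have : w - 1 / y = ((y + h) * w - 1 - h / y) / (y + h) := by field_simp; ring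
      rw [this, abs_div, abs_of_pos hy1, div_le_div_iff₀ hy1 hy]
      have h3 : |h / y| ≤ δ := by
        rw [abs_div, abs_of_pos hy, div_le_iff₀ hy]; exact hh
      have h4 : |(y + h) * w - 1 - h / y| ≤ 2 * δ := by
        refine (abs_sub _ _).trans ?_; linarith
      calc _ ≤ 2 * δ * y := by gcongr
        _ ≤ 4 * δ * (y + h) := by nlinarith
    have hu1 : Real.log (φ (y + h)) - Real.log (φ y) - h / y ≤ |h| * (4 * δ / y) := by
      calc _ ≤ h * (v - 1 / y) := by linarith [show h * (v - 1 / y) = h * v - h / y by ring]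
        _ ≤ |h * (v - 1 / y)| := le_abs_self _
        _ ≤ _ := by rw [abs_mul]; gcongr
    have hu2 : -(|h| * (4 * δ / y)) ≤ Real.log (φ (y + h)) - Real.log (φ y) - h / y := by
      calc _ ≤ -|h * (w - 1 / y)| := by rw [abs_mul]; gcongr
        _ ≤ h * (w - 1 / y) := neg_abs_le _
        _ ≤ _ := by linarith [show h * (w - 1 / y) = h * w - h / y by ring]
    rw [show 4 * δ * (|h| / y) = |h| * (4 * δ / y) by ring]
    exact abs_le.2 ⟨hu2, hu1⟩

end EdgeProfile

/-! ### Pointwise expansion of the two gaps -/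

theorem abs_exp_sub_taylor_two_le {u : ℝ} (hu : |u| ≤ 1) :
    |Real.exp u - 1 - u - u ^ 2 / 2| ≤ |u| ^ 3 / 2 := by
  have := Real.exp_bound hu (n := 3) (by norm_num)
  norm_num [Finset.sum_range_succ] at this
  rw [show Real.exp u - 1 - u - u ^ 2 / 2 = Real.exp u - (1 + u + u ^ 2 / 2) by ring]
  refine this.trans ?_
  have : 0 ≤ |u| ^ 3 := by positivity
  nlinarith

/-- Second-order expansion of the gap between weighted arithmetic and geometric means. -/
theorem abs_mean_gap_le {s u : ℝ} (hs : s ∈ Ioo (0 : ℝ) 1) (hu : |u| ≤ 1) :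
    |s * Real.exp u + (1 - s) - Real.exp (s * u) - s * (1 - s) * (u ^ 2 / 2)| ≤ |u| ^ 3 := by
  have hsu : |s * u| ≤ |u| := by
    rw [abs_mul, abs_of_pos hs.1]
    exact mul_le_of_le_one_left (abs_nonneg _) hs.2.le
  have h1 := abs_exp_sub_taylor_two_le hu
  have h2 := abs_exp_sub_taylor_two_le (hsu.trans hu)
  have h3 : |s * u| ^ 3 ≤ |u| ^ 3 := by gcongr
  have e : s * Real.exp u + (1 - s) - Real.exp (s * u) - s * (1 - s) * (u ^ 2 / 2)
      = s * (Real.exp u - 1 - u - u ^ 2 / 2)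
        - (Real.exp (s * u) - 1 - s * u - (s * u) ^ 2 / 2) := by ring
  rw [e]
  refine (abs_sub _ _).trans ?_
  rw [abs_mul, abs_of_pos hs.1]
  have : s * |Real.exp u - 1 - u - u ^ 2 / 2| ≤ |Real.exp u - 1 - u - u ^ 2 / 2| :=
    mul_le_of_le_one_left (abs_nonneg _) hs.2.le
  linarith

/-- `s p(y+h) + (1-s) p(y) - p(y+h)^s p(y)^(1-s)`. -/
def meanGap (p : ℝ → ℝ) (s h y : ℝ) : ℝ :=
  s * p (y + h) + (1 - s) * p y - p (y + h) ^ s * p y ^ (1 - s)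

theorem meanGap_nonneg {p : ℝ → ℝ} (hp : ∀ y, 0 ≤ p y) {s : ℝ} (hs : s ∈ Ioo (0 : ℝ) 1) (h y : ℝ) :
    0 ≤ meanGap p s h y := by
  have := Real.geom_mean_le_arith_mean2_weighted hs.1.le (sub_nonneg.2 hs.2.le) (hp (y + h)) (hp y)
    (by ring)
  unfold meanGap
  linarith

/-- Factoring out p(y) leaves a function of the log increment alone, to which `abs_mean_gap_le`
applies. -/
theorem meanGap_eq {p : ℝ → ℝ} {s h y : ℝ} (h1 : 0 < p y) (h2 : 0 < p (y + h)) :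
    meanGap p s h y = p y * (s * Real.exp (Real.log (p (y + h)) - Real.log (p y)) + (1 - s)
      - Real.exp (s * (Real.log (p (y + h)) - Real.log (p y)))) := by
  have e1 : p (y + h) = p y * Real.exp (Real.log (p (y + h)) - Real.log (p y)) := by
    rw [Real.exp_sub, Real.exp_log h1, Real.exp_log h2]; field_simp
  have e2 : p (y + h) ^ s * p y ^ (1 - s)
      = p y * Real.exp (s * (Real.log (p (y + h)) - Real.log (p y))) := by
    rw [Real.rpow_def_of_pos h1, Real.rpow_def_of_pos h2, ← Real.exp_add]
    conv_rhs => rw [← Real.exp_log h1, ← Real.exp_add, Real.log_exp]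
    congr 1; ring
  unfold meanGap
  rw [e2]
  nth_rewrite 1 [e1]
  ring

/-- `p(y) - p(y+h) e^{-h (log p)'(y)}`. -/
def tangentGap (p : ℝ → ℝ) (h y : ℝ) : ℝ :=
  p y - p (y + h) * Real.exp (-(h * (deriv p y / p y)))

theorem sq_sub_sq_le {u τ κ : ℝ} (h : |u - τ| ≤ κ * |τ|) (hκ : κ ≤ 1) :
    |u ^ 2 - τ ^ 2| ≤ 3 * κ * τ ^ 2 := by
  have h1 : |u + τ| ≤ 3 * |τ| := by
    calc |u + τ| = |(u - τ) + 2 * τ| := by ring_nf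
      _ ≤ |u - τ| + |2 * τ| := abs_add_le _ _
      _ ≤ κ * |τ| + 2 * |τ| := by rw [abs_mul]; norm_num; exact h
      _ ≤ 3 * |τ| := by nlinarith [abs_nonneg τ]
  calc |u ^ 2 - τ ^ 2| = |u - τ| * |u + τ| := by rw [← abs_mul]; ring_nf
    _ ≤ (κ * |τ|) * (3 * |τ|) := by gcongr; exact (abs_nonneg _).trans h
    _ = 3 * κ * τ ^ 2 := by rw [← sq_abs τ]; ring

theorem abs_cube_le {u τ δ : ℝ} (h : |u - τ| ≤ |τ|) (hτ : |τ| ≤ δ) :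
    |u| ^ 3 ≤ 8 * δ * τ ^ 2 := by
  have : |u| ≤ 2 * |τ| := by
    calc |u| = |(u - τ) + τ| := by ring_nf
      _ ≤ |u - τ| + |τ| := abs_add_le _ _
      _ ≤ _ := by linarith
  calc |u| ^ 3 ≤ (2 * |τ|) ^ 3 := by gcongr
    _ = 8 * (|τ| * τ ^ 2) := by rw [← sq_abs τ]; ring
    _ ≤ 8 * (δ * τ ^ 2) := by gcongr
    _ = _ := by ring

/-- In the application u is the log increment, τ = h/y its leading term, P = φ(y) and B = A y, so
that B τ² = A h²/y. The bound is uniform in s. -/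
theorem abs_meanGap_sub_le {s u τ δ P B : ℝ} (hs : s ∈ Ioo (0 : ℝ) 1) (hδ : 0 < δ)
    (hδ' : δ ≤ 1 / 80) (hτ : |τ| ≤ δ) (hu : |u - τ| ≤ 4 * δ * |τ|) (hB : 0 < B) (hP : 0 < P)
    (hPB : |P - B| ≤ δ * B) :
    |P * (s * Real.exp u + (1 - s) - Real.exp (s * u)) - s * (1 - s) / 2 * (B * τ ^ 2)|
      ≤ 40 * (δ * (B * τ ^ 2)) := by
  have hτ0 := abs_nonneg τ
  have hκ : 4 * δ * |τ| ≤ |τ| := by nlinarith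
  have hu1 : |u| ≤ 1 := by
    calc |u| = |(u - τ) + τ| := by ring_nf
      _ ≤ |u - τ| + |τ| := abs_add_le _ _
      _ ≤ 1 := by linarith
  have c1 := sq_sub_sq_le hu (by linarith)
  have c2 := abs_cube_le (hu.trans hκ) hτ
  have c3 := abs_mean_gap_le hs hu1
  have hs2 : s * (1 - s) ≤ 1 / 4 := by nlinarith [sq_nonneg (s - 1 / 2)]
  have hs0 : 0 ≤ s * (1 - s) := mul_nonneg hs.1.le (sub_nonneg.2 hs.2.le)
  generalize s * Real.exp u + (1 - s) - Real.exp (s * u) = E at *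
  generalize hm : s * (1 - s) = m at *
  have hD : 0 ≤ δ * τ ^ 2 := by positivity
  have c4 : |E - m / 2 * τ ^ 2| ≤ 10 * (δ * τ ^ 2) := by
    calc |E - m / 2 * τ ^ 2| = |(E - m * (u ^ 2 / 2)) + m / 2 * (u ^ 2 - τ ^ 2)| := by ring_nf
      _ ≤ |E - m * (u ^ 2 / 2)| + |m / 2 * (u ^ 2 - τ ^ 2)| := abs_add_le _ _
      _ ≤ 8 * δ * τ ^ 2 + (1 / 4) / 2 * (3 * (4 * δ) * τ ^ 2) := by
        rw [abs_mul (m / 2), abs_of_nonneg (by positivity : 0 ≤ m / 2)]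
        gcongr
        exact c3.trans c2
      _ ≤ _ := by linarith
  have e : P * E - m / 2 * (B * τ ^ 2) = P * (E - m / 2 * τ ^ 2) + m / 2 * τ ^ 2 * (P - B) := by ring
  have hP2 : P ≤ 2 * B := by nlinarith [(abs_le.1 hPB).2]
  rw [e]
  calc _ ≤ |P * (E - m / 2 * τ ^ 2)| + |m / 2 * τ ^ 2 * (P - B)| := abs_add_le _ _
    _ ≤ 2 * B * (10 * (δ * τ ^ 2)) + (1 / 4) / 2 * τ ^ 2 * (δ * B) := by
        rw [abs_mul, abs_of_pos hP, abs_mul (m / 2 * τ ^ 2),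
          abs_of_nonneg (by positivity : 0 ≤ m / 2 * τ ^ 2)]
        gcongr
    _ ≤ _ := by
      have : 0 ≤ δ * (B * τ ^ 2) := by positivity
      linarith

/-- Here v = h φ'(y)/φ(y), so u and v both approximate τ. The difference u - v is only O(δτ), but it
enters quadratically: exp u - v - exp(u - v) equals (exp u - 1 - u) minus (exp(u - v) - 1 - (u -
v)), which is τ²/2 up to O(δτ²). -/
theorem le_mul_tangent_remainder {u v τ δ P B : ℝ} (hδ : 0 < δ)
    (hδ' : δ ≤ 1 / 80) (hτ : |τ| ≤ δ) (hu : |u - τ| ≤ 4 * δ * |τ|) (hv : |v - τ| ≤ δ * |τ|)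
    (hB : 0 < B) (hPB : |P - B| ≤ δ * B) :
    (1 / 2 - 40 * δ) * (B * τ ^ 2) ≤ P * (Real.exp u - v - Real.exp (u - v)) := by
  have hτ0 := abs_nonneg τ
  have hκ : 4 * δ * |τ| ≤ |τ| := by nlinarith
  have hδτ : δ * |τ| ≤ 1 / 80 * (1 / 80) := by gcongr; linarith
  have hu1 : |u| ≤ 1 := by
    calc |u| = |(u - τ) + τ| := by ring_nf
      _ ≤ |u - τ| + |τ| := abs_add_le _ _
      _ ≤ 1 := by linarith
  have c1 := (abs_le.1 (sq_sub_sq_le hu (by linarith))).1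
  have c2 := abs_cube_le (hu.trans hκ) hτ
  have hw : |u - v| ≤ 5 * δ * |τ| := by
    calc |u - v| = |(u - τ) - (v - τ)| := by ring_nf
      _ ≤ |u - τ| + |v - τ| := abs_sub _ _
      _ ≤ _ := by linarith
  have d1 := (abs_le.1 (Real.abs_exp_sub_one_sub_id_le (x := u - v) (by linarith))).2
  have hD : 0 ≤ δ * τ ^ 2 := by positivity
  have d2 : (u - v) ^ 2 ≤ 3 * (δ * τ ^ 2) := by
    rw [← sq_abs]
    calc |u - v| ^ 2 ≤ (5 * δ * |τ|) ^ 2 := by gcongr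
      _ = 25 * δ * (δ * τ ^ 2) := by rw [mul_pow, sq_abs]; ring
      _ ≤ 3 * (δ * τ ^ 2) := by gcongr; linarith
  have d3 := (abs_le.1 (abs_exp_sub_taylor_two_le hu1)).1
  have key : (1 / 2 - 20 * δ) * τ ^ 2 ≤ Real.exp u - v - Real.exp (u - v) := by linarith
  have hτ2 : 0 ≤ τ ^ 2 := sq_nonneg τ
  have hP : (1 - δ) * B ≤ P := by linarith [(abs_le.1 hPB).1]
  have h0 : 0 ≤ 1 / 2 - 20 * δ := by linarith
  calc (1 / 2 - 40 * δ) * (B * τ ^ 2) ≤ ((1 - δ) * (1 / 2 - 20 * δ)) * (B * τ ^ 2) := by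
        gcongr; nlinarith
    _ = ((1 - δ) * B) * ((1 / 2 - 20 * δ) * τ ^ 2) := by ring
    _ ≤ P * (Real.exp u - v - Real.exp (u - v)) := by
      gcongr
      exact le_trans (by have : 0 ≤ 1 - δ := by linarith
                         positivity) hP

namespace EdgeProfile

variable {φ : ℝ → ℝ} {L A : ℝ}

theorem nonneg (hφ : EdgeProfile φ L A) {y : ℝ} (hy : y < L) : 0 ≤ φ y := by
  rcases le_or_gt y 0 with h | h
  · rw [hφ.zero y h]
  · exact (hφ.pos y ⟨h, hy⟩).le

/-- Pointwise expansions of both gaps at the edge. -/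
theorem exists_gap_bound (hφ : EdgeProfile φ L A) {δ : ℝ} (hδ : 0 < δ) (hδ' : δ ≤ 1 / 80) :
    ∃ η, 0 < η ∧ η < L / 2 ∧ ∀ y, 0 < y → y ≤ η → ∀ h, |h| ≤ δ * y →
      (∀ s ∈ Ioo (0 : ℝ) 1,
        |meanGap φ s h y - s * (1 - s) / 2 * (A * (h ^ 2 / y))| ≤ 40 * (δ * (A * (h ^ 2 / y)))) ∧
      (1 / 2 - 40 * δ) * (A * (h ^ 2 / y))
        ≤ tangentGap φ h y - (φ y - φ (y + h) + h * deriv φ y) := by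
  obtain ⟨η, hη, hηL, H⟩ := hφ.exists_edge_bound hδ (by linarith)
  refine ⟨η, hη, hηL, fun y hy hyη h hh => ?_⟩
  obtain ⟨b1, b2, b3⟩ := H y hy hyη
  have b3 := b3 h hh
  have hh' := abs_le.1 hh
  have hδy : δ * y ≤ 1 / 80 * y := by gcongr
  have hp : 0 < φ y := hφ.pos y ⟨hy, by linarith⟩
  have hp' : 0 < φ (y + h) := hφ.pos _ ⟨by linarith, by linarith⟩
  have hA := hφ.coeff_pos
  have hAy : 0 < A * y := mul_pos hA hy
  have hτδ : |h / y| ≤ δ := by rw [abs_div, abs_of_pos hy, div_le_iff₀ hy]; exact hh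
  have eτ : A * (h ^ 2 / y) = A * y * (h / y) ^ 2 := by field_simp
  rw [show |h| / y = |h / y| by rw [abs_div, abs_of_pos hy]] at b3
  rw [eτ]
  constructor
  · intro s hs
    rw [meanGap_eq hp hp']
    exact abs_meanGap_sub_le hs hδ hδ' hτδ b3 hAy hp b1
  · have b2' : |h * (deriv φ y / φ y) - h / y| ≤ δ * |h / y| := by
      have : h * (deriv φ y / φ y) - h / y = h / y * (y * (deriv φ y / φ y) - 1) := by field_simp
      rw [this, abs_mul, mul_comm]
      gcongr
    have e1 : φ (y + h) = φ y * Real.exp (Real.log (φ (y + h)) - Real.log (φ y)) := by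
      rw [Real.exp_sub, Real.exp_log hp, Real.exp_log hp']; field_simp
    -- Subtracting the first-order remainder cancels the terms linear in h, whose relative error δ
    -- would swamp h²/y. Their integral is evaluated separately in `exists_integral_remainder_ge`.
    have e3 : tangentGap φ h y - (φ y - φ (y + h) + h * deriv φ y)
        = φ y * (Real.exp (Real.log (φ (y + h)) - Real.log (φ y)) - h * (deriv φ y / φ y)
          - Real.exp (Real.log (φ (y + h)) - Real.log (φ y) - h * (deriv φ y / φ y))) := by
      unfold tangentGap
      rw [sub_eq_add_neg (_ - _) (h * _), Real.exp_add]
      have e2 : h * deriv φ y = φ y * (h * (deriv φ y / φ y)) := by field_simp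
      nth_rewrite 1 2 [e1]
      rw [e2]
      ring
    rw [e3]
    exact le_mul_tangent_remainder hδ hδ' hτδ b3 b2' hAy b1

end EdgeProfile

/-! ### The normalization -x² log x -/

theorem gLog_pos {x : ℝ} (h0 : 0 < x) (h1 : x < 1) : 0 < gLog x := by
  have := Real.log_neg h0 h1
  have := mul_neg_of_pos_of_neg (pow_pos h0 2) this
  unfold gLog
  linarith

theorem eventually_nhdsGT_zero_lt {c : ℝ} (hc : 0 < c) : ∀ᶠ ε : ℝ in 𝓝[>] 0, ε < c := by
  filter_upwards [Ioo_mem_nhdsGT hc] with ε h using h.2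

theorem eventually_gLog_pos : ∀ᶠ ε : ℝ in 𝓝[>] 0, 0 < gLog ε := by
  filter_upwards [Ioo_mem_nhdsGT (zero_lt_one' ℝ)] with ε hε using gLog_pos hε.1 hε.2

/-- This is what absorbs every O(ε²) error: g(ε)/ε² = -log ε tends to infinity. -/
theorem eventually_mul_sq_le_gLog (K : ℝ) {δ : ℝ} (hδ : 0 < δ) :
    ∀ᶠ ε : ℝ in 𝓝[>] 0, K * ε ^ 2 ≤ δ * gLog ε := by
  filter_upwards [Real.tendsto_log_nhdsGT_zero.eventually_le_atBot (-(K / δ)), self_mem_nhdsWithin]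
    with ε h1 h2
  have h3 : K ≤ δ * -Real.log ε := by
    have : K / δ ≤ -Real.log ε := by linarith
    rwa [div_le_iff₀' hδ] at this
  unfold gLog
  calc K * ε ^ 2 ≤ (δ * -Real.log ε) * ε ^ 2 := by gcongr
    _ = _ := by ring

theorem tendsto_gLog_zero : Tendsto gLog (𝓝[>] 0) (𝓝 0) := by
  have h1 : Tendsto (fun x : ℝ => Real.log x * x) (𝓝[>] 0) (𝓝 0) := by
    simpa using tendsto_log_mul_rpow_nhdsGT_zero (r := 1) one_pos
  have h2 : Tendsto (fun x : ℝ => x) (𝓝[>] (0 : ℝ)) (𝓝 0) := nhdsWithin_le_nhds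
  have := (h1.mul h2).neg
  simp only [mul_zero, neg_zero] at this
  refine this.congr fun x => ?_
  unfold gLog; ring

theorem isScalingExponent_gLog : IsScalingExponent gLog 2 := by
  refine ⟨by norm_num, fun x hx => ?_⟩
  have h1 : Tendsto (fun ε : ℝ => Real.log x / Real.log ε) (𝓝[>] 0) (𝓝 0) :=
    tendsto_const_nhds.div_atBot Real.tendsto_log_nhdsGT_zero
  have h2 := (h1.add_const 1).const_mul (x ^ 2)
  rw [zero_add, mul_one, ← Real.rpow_natCast] at h2
  push_cast at h2
  refine h2.congr' ?_
  filter_upwards [Ioo_mem_nhdsGT (zero_lt_one' ℝ)] with ε hε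
  have hl := (Real.log_neg hε.1 hε.2).ne
  have hε0 := hε.1.ne'
  unfold gLog
  rw [Real.log_mul hx.ne' hε0]
  rw [Real.rpow_two]
  field_simp

/-! ### Integrals of the gaps over an edge -/

namespace EdgeProfile

variable {φ : ℝ → ℝ} {L A : ℝ}

/-- A crude linear bound, also valid for y ≤ 0, for the zone y = O(|h|) where the expansion in h/y
fails. -/
theorem exists_le_two_mul (hφ : EdgeProfile φ L A) :
    ∃ r, 0 < r ∧ r < L ∧ ∀ y, y ≤ r → 0 ≤ φ y ∧ φ y ≤ 2 * A * max y 0 := by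
  obtain ⟨η, hη, hηL, H⟩ := hφ.exists_edge_bound (δ := 1 / 10) (by norm_num) le_rfl
  refine ⟨η, hη, by linarith [hφ.length_pos], fun y hy => ⟨hφ.nonneg (by linarith [hφ.length_pos]), ?_⟩⟩
  rcases le_or_gt y 0 with h | h
  · simp [hφ.zero y h, h]
  · rw [max_eq_left h.le]
    have := (abs_le.1 (H y h hy).1).2
    have hA := mul_pos hφ.coeff_pos h
    linarith

theorem continuousOn (hφ : EdgeProfile φ L A) : ContinuousOn φ (Iio L) := by
  intro y hy
  refine ContinuousAt.continuousWithinAt ?_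
  rcases lt_trichotomy y 0 with h | rfl | h
  · have : φ =ᶠ[𝓝 y] fun _ => 0 := by
      filter_upwards [Iio_mem_nhds h] with z hz using hφ.zero z (le_of_lt hz)
    exact continuousAt_const.congr this.symm
  · obtain ⟨r, hr, -, H⟩ := hφ.exists_le_two_mul
    rw [ContinuousAt, hφ.zero 0 le_rfl]
    have h1 : Tendsto (fun y : ℝ => 2 * A * max y 0) (𝓝 0) (𝓝 (2 * A * max 0 0)) :=
      Continuous.tendsto (by fun_prop) 0
    rw [max_self, mul_zero] at h1
    refine tendsto_of_tendsto_of_tendsto_of_le_of_le' tendsto_const_nhds h1 ?_ ?_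
    · filter_upwards [Iio_mem_nhds hr] with y hy using (H y (le_of_lt hy)).1
    · filter_upwards [Iio_mem_nhds hr] with y hy using (H y (le_of_lt hy)).2
  · exact (hφ.differentiableAt ⟨h, hy⟩).continuousAt

theorem meanGap_continuousOn (hφ : EdgeProfile φ L A) {s h : ℝ} (hs : s ∈ Ioo (0 : ℝ) 1) :
    ContinuousOn (meanGap φ s h) (Iio (L - |h|)) := by
  have h1 : ContinuousOn φ (Iio (L - |h|)) :=
    hφ.continuousOn.mono (Iio_subset_Iio (by linarith [abs_nonneg h]))
  have h2 : ContinuousOn (fun y => φ (y + h)) (Iio (L - |h|)) :=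
    hφ.continuousOn.comp (by fun_prop) fun y hy => by
      have := le_abs_self h; simp only [mem_Iio] at *; linarith
  unfold meanGap
  exact ((h2.const_smul s).add (h1.const_smul (1 - s))).sub
    ((h2.rpow_const fun _ _ => Or.inr hs.1.le).mul
      (h1.rpow_const fun _ _ => Or.inr (sub_nonneg.2 hs.2.le)))

theorem tangentGap_continuousOn (hφ : EdgeProfile φ L A) {h : ℝ} :
    ContinuousOn (tangentGap φ h) (Ioo 0 (L - |h|)) := by
  have hs : Ioo 0 (L - |h|) ⊆ Ioo 0 L := Ioo_subset_Ioo_right (by linarith [abs_nonneg h])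
  have h1 : ContinuousOn φ (Ioo 0 (L - |h|)) := hφ.continuousOn.mono fun y hy => (hs hy).2
  have h2 : ContinuousOn (fun y => φ (y + h)) (Ioo 0 (L - |h|)) :=
    hφ.continuousOn.comp (by fun_prop) fun y hy => by
      have := le_abs_self h; simp only [mem_Iio, mem_Ioo] at *; linarith
  have h3 : ContinuousOn (deriv φ) (Ioo 0 (L - |h|)) :=
    (hφ.contDiffOn.continuousOn_deriv_of_isOpen isOpen_Ioo le_rfl).mono hs
  unfold tangentGap
  exact h1.sub (h2.mul (continuousOn_const.mul
    (h3.div h1 fun y hy => (hφ.pos y (hs hy)).ne')).neg.rexp)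

theorem integral_sq_div {l η A h : ℝ} (hl : 0 < l) (hη : 0 < η) :
    ∫ y in l..η, A * (h ^ 2 / y) = A * (h ^ 2 * (Real.log η - Real.log l)) := by
  simp_rw [div_eq_mul_inv]
  rw [intervalIntegral.integral_const_mul, intervalIntegral.integral_const_mul,
    integral_inv_of_pos hl hη, Real.log_div hη.ne' hl.ne']

/-- The integral of `A h² / y` over `[|h| / δ, η]` is `A (g(|h|) + O(h²))`. -/
theorem eventually_integral_sq_div (hA : 0 < A) {δ' η κ : ℝ} (hδ' : 0 < δ') (hη : 0 < η) (hκ : 0 < κ) :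
    ∀ᶠ ε in 𝓝[>] (0 : ℝ), ∀ h, |h| = ε →
      |(∫ y in (ε / δ')..η, A * (h ^ 2 / y)) - A * gLog ε| ≤ κ * gLog ε := by
  filter_upwards [self_mem_nhdsWithin,
    eventually_mul_sq_le_gLog (A * |Real.log η + Real.log δ'|) hκ] with ε hε h1 h hh
  have hε : 0 < ε := hε
  rw [integral_sq_div (div_pos hε hδ') hη, Real.log_div hε.ne' hδ'.ne', ← sq_abs h, hh]
  have : A * (ε ^ 2 * (Real.log η - (Real.log ε - Real.log δ'))) - A * gLog ε
      = A * ε ^ 2 * (Real.log η + Real.log δ') := by unfold gLog; ring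
  rw [this, abs_mul, abs_of_nonneg (by positivity)]
  linarith

/-- The edge contribution to the gap between arithmetic and geometric means. -/
theorem eventually_integral_meanGap (hφ : EdgeProfile φ L A) {κ : ℝ} (hκ : 0 < κ) :
    ∃ η, 0 < η ∧ η < L / 2 ∧ ∀ᶠ ε in 𝓝[>] (0 : ℝ), ∀ h, |h| = ε → ∀ s ∈ Ioo (0 : ℝ) 1,
      |(∫ y in (-ε)..η, meanGap φ s h y) - s * (1 - s) / 2 * A * gLog ε| ≤ κ * gLog ε := by
  have hA := hφ.coeff_pos
  -- Chosen so that the pointwise error 40δ, integrated against at most 2A g, costs at most (κ/2) g.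
  set δ : ℝ := min (1 / 80) (κ / (160 * A)) with hδdef
  have hδ : 0 < δ := lt_min (by norm_num) (by positivity)
  have hδA : 40 * δ * (2 * A) ≤ κ / 2 := by
    have : δ ≤ κ / (160 * A) := min_le_right _ _
    rw [le_div_iff₀ (by positivity)] at this
    linarith
  obtain ⟨η, hη, hηL, H⟩ := hφ.exists_gap_bound hδ (min_le_left _ _)
  obtain ⟨r, hr, hrL, Hr⟩ := hφ.exists_le_two_mul
  refine ⟨η, hη, hηL, ?_⟩
  have hm : 0 < min A (κ / 4) := lt_min hA (by positivity)
  -- The expansion requires |h| ≤ δ y, that is y ≥ Mε; below Mε lies the core.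
  set M : ℝ := 1 / δ with hM
  have hM0 : 0 < M := by positivity
  filter_upwards [self_mem_nhdsWithin, eventually_gLog_pos,
    eventually_integral_sq_div hA hδ hη hm,
    eventually_mul_sq_le_gLog (4 * A * (M + 1) ^ 2) (δ := κ / 4) (by positivity),
    eventually_nhdsGT_zero_lt (c := r / (M + 1)) (by positivity), eventually_nhdsGT_zero_lt (c := η / M) (by positivity),
    eventually_nhdsGT_zero_lt (c := L / 2) (by linarith [hφ.length_pos])] with ε hε hg hI hK hε1 hε2 hε3 h hh s hs
  have hε : 0 < ε := hε
  have hεM : ε / δ = M * ε := by rw [hM]; ring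
  rw [lt_div_iff₀ (by positivity)] at hε1
  rw [lt_div_iff₀ hM0] at hε2
  have hh' := abs_le.1 hh.le
  have hI := hI h hh
  rw [hεM] at hI
  have hsub : ∀ c d, c < L - ε → d < L - ε → IntervalIntegrable (meanGap φ s h) volume c d := by
    intro c d hc hd
    refine ((hφ.meanGap_continuousOn (h := h) hs).mono fun y hy => ?_).intervalIntegrable
    rw [mem_Iio, hh]
    exact lt_of_le_of_lt hy.2 (max_lt hc hd)
  have i1 := hsub (-ε) (M * ε) (by linarith) (by linarith)
  have i2 := hsub (M * ε) η (by linarith) (by linarith)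
  rw [← intervalIntegral.integral_add_adjacent_intervals i1 i2]
  -- On the core both densities are O(ε) and the interval has length O(ε), so the contribution is
  -- O(ε²).
  have core : |∫ y in (-ε)..(M * ε), meanGap φ s h y| ≤ κ / 4 * gLog ε := by
    have hle : -ε ≤ M * ε := by nlinarith
    have : ‖∫ y in (-ε)..(M * ε), meanGap φ s h y‖ ≤ (4 * A * (M + 1) * ε) * |M * ε - -ε| := by
      apply intervalIntegral.norm_integral_le_of_norm_le_const
      intro y hy
      rw [uIoc_of_le hle] at hy
      have p1 := Hr y (by linarith [hy.2])
      have p2 := Hr (y + h) (by linarith [hy.2, hh'.2])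
      have m1 : max y 0 ≤ (M + 1) * ε := max_le (by linarith [hy.2]) (by positivity)
      have m2 : max (y + h) 0 ≤ (M + 1) * ε := max_le (by linarith [hy.2, hh'.2]) (by positivity)
      have q1 : φ y ≤ 2 * A * ((M + 1) * ε) := p1.2.trans (by gcongr)
      have q2 : φ (y + h) ≤ 2 * A * ((M + 1) * ε) := p2.2.trans (by gcongr)
      have r1 : 0 ≤ φ (y + h) ^ s * φ y ^ (1 - s) :=
        mul_nonneg (Real.rpow_nonneg p2.1 _) (Real.rpow_nonneg p1.1 _)
      have r2 := Real.geom_mean_le_arith_mean2_weighted hs.1.le (sub_nonneg.2 hs.2.le) p2.1 p1.1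
        (by ring)
      have s1 : s * φ (y + h) ≤ φ (y + h) := mul_le_of_le_one_left p2.1 hs.2.le
      have s2 : (1 - s) * φ y ≤ φ y := mul_le_of_le_one_left p1.1 (by linarith [hs.1])
      rw [Real.norm_eq_abs, abs_le]
      unfold meanGap
      constructor <;> linarith
    rw [Real.norm_eq_abs, abs_of_nonneg (by linarith : 0 ≤ M * ε - -ε)] at this
    refine this.trans (le_trans (le_of_eq ?_) hK)
    ring
  have edge : |(∫ y in (M * ε)..η, meanGap φ s h y)
      - s * (1 - s) / 2 * ∫ y in (M * ε)..η, A * (h ^ 2 / y)|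
      ≤ 40 * δ * ∫ y in (M * ε)..η, A * (h ^ 2 / y) := by
    have i3 : IntervalIntegrable (fun y => A * (h ^ 2 / y)) volume (M * ε) η := by
      apply ContinuousOn.intervalIntegrable
      rw [uIcc_of_le (by linarith)]
      exact continuousOn_const.mul (continuousOn_const.div continuousOn_id fun y hy =>
        (lt_of_lt_of_le (by positivity) hy.1).ne')
    rw [← intervalIntegral.integral_const_mul, ← intervalIntegral.integral_const_mul,
      ← intervalIntegral.integral_sub i2 (i3.const_mul _), ← Real.norm_eq_abs]
    apply intervalIntegral.norm_integral_le_of_norm_le (by linarith) _ (i3.const_mul _)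
    refine ae_of_all _ fun y hy => ?_
    have hy0 : 0 < y := lt_of_le_of_lt (by positivity) hy.1
    have hhy : |h| ≤ δ * y := by
      rw [hh, ← div_le_iff₀' hδ, hεM]; exact hy.1.le
    rw [Real.norm_eq_abs, mul_assoc 40 δ]
    exact (H y hy0 hy.2 h hhy).1 s hs
  generalize (∫ y in (M * ε)..η, meanGap φ s h y) = X at *
  generalize (∫ y in (-ε)..(M * ε), meanGap φ s h y) = Y at *
  generalize (∫ y in (M * ε)..η, A * (h ^ 2 / y)) = Z at *
  have hs0 : 0 ≤ s * (1 - s) := mul_nonneg hs.1.le (sub_nonneg.2 hs.2.le)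
  have hs2 : s * (1 - s) ≤ 1 := by nlinarith [sq_nonneg (s - 1 / 2)]
  have hZ : Z ≤ 2 * A * gLog ε := by
    have := (abs_le.1 hI).2
    have : min A (κ / 4) * gLog ε ≤ A * gLog ε := by gcongr; exact min_le_left _ _
    linarith
  have hZ2 : |Z - A * gLog ε| ≤ κ / 4 * gLog ε := hI.trans (by gcongr; exact min_le_right _ _)
  have e1 : 40 * δ * Z ≤ κ / 2 * gLog ε := by
    calc 40 * δ * Z ≤ 40 * δ * (2 * A * gLog ε) := by gcongr
      _ = 40 * δ * (2 * A) * gLog ε := by ring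
      _ ≤ _ := by gcongr
  have e : Y + X - s * (1 - s) / 2 * A * gLog ε
      = Y + (X - s * (1 - s) / 2 * Z) + s * (1 - s) / 2 * (Z - A * gLog ε) := by ring
  rw [e]
  calc _ ≤ |Y| + |X - s * (1 - s) / 2 * Z| + |s * (1 - s) / 2 * (Z - A * gLog ε)| := abs_add_three _ _ _
    _ ≤ κ / 4 * gLog ε + κ / 2 * gLog ε + 1 / 2 * (κ / 4 * gLog ε) := by
      rw [abs_mul (s * (1 - s) / 2), abs_of_nonneg (by positivity : 0 ≤ s * (1 - s) / 2)]
      gcongr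
      exact edge.trans e1
    _ ≤ _ := by nlinarith [mul_pos hκ hg]

/-- The integral of the first-order remainder over an edge interval is `O(h²)`. -/
theorem exists_integral_remainder_ge (hφ : EdgeProfile φ L A) {η M : ℝ} (hη : 0 < η) (hηL : η < L / 2)
    (hM : 1 < M) :
    ∃ K, ∀ᶠ ε in 𝓝[>] (0 : ℝ), ∀ h, |h| = ε →
      -(K * ε ^ 2) ≤ ∫ y in (M * ε)..η, (φ y - φ (y + h) + h * deriv φ y) := by
  have hA := hφ.coeff_pos
  have hL := hφ.length_pos
  obtain ⟨r, hr, hrL, Hr⟩ := hφ.exists_le_two_mul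
  -- Differentiability at the outer endpoint gives |φ(y) - φ(η)| ≤ C|y - η| near η, which makes that
  -- boundary term O(ε²).
  obtain ⟨C, hC⟩ := (hφ.differentiableAt ⟨hη, by linarith⟩ : DifferentiableAt ℝ φ η).isBigO_sub.bound
  obtain ⟨ρ, hρ, hC⟩ := Metric.eventually_nhds_iff.1 hC
  refine ⟨|C| + 2 * A * (M + 1), ?_⟩
  have hM0 : 0 < M := by linarith
  filter_upwards [self_mem_nhdsWithin, eventually_nhdsGT_zero_lt (c := r / (M + 1)) (by positivity),
    eventually_nhdsGT_zero_lt (c := η / M) (by positivity), eventually_nhdsGT_zero_lt (c := L / 2) (by linarith), eventually_nhdsGT_zero_lt hρ]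
    with ε hε hε1 hε2 hε3 hε4 h hh
  have hε : 0 < ε := hε
  rw [lt_div_iff₀ (by positivity)] at hε1
  rw [lt_div_iff₀ hM0] at hε2
  have hh' := abs_le.1 hh.le
  have hMε : ε < M * ε := by nlinarith
  have ii : ∀ c d, c < L → d < L → IntervalIntegrable φ volume c d := fun c d hc hd =>
    (hφ.continuousOn.mono fun y hy => lt_of_le_of_lt hy.2 (max_lt hc hd)).intervalIntegrable
  have hsub : uIcc (M * ε) η ⊆ Ioo 0 L := by
    rw [uIcc_of_le (by linarith)]
    exact fun y hy => ⟨by linarith [hy.1], by linarith [hy.2]⟩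
  have i1 := ii (M * ε) η (by linarith) (by linarith)
  have i2 : IntervalIntegrable (fun y => φ (y + h)) volume (M * ε) η := by
    apply ContinuousOn.intervalIntegrable
    refine hφ.continuousOn.comp (by fun_prop) fun y hy => ?_
    rw [uIcc_of_le (by linarith)] at hy
    simp only [mem_Iio]
    linarith [hy.2]
  have i3 : IntervalIntegrable (deriv φ) volume (M * ε) η :=
    ((hφ.contDiffOn.continuousOn_deriv_of_isOpen isOpen_Ioo le_rfl).mono hsub).intervalIntegrable
  -- The integral telescopes to (∫ φ over [Mε, Mε+h] - hφ(Mε)) minus the same expression at η. Each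
  -- is O(ε²): at Mε because φ itself is O(ε) there.
  rw [intervalIntegral.integral_add (i1.sub i2) (i3.const_mul h), intervalIntegral.integral_sub i1 i2,
    intervalIntegral.integral_const_mul, intervalIntegral.integral_comp_add_right,
    intervalIntegral.integral_deriv_eq_sub (fun y hy => hφ.differentiableAt (hsub hy)) i3]
  have j1 := ii (M * ε) (M * ε + h) (by linarith) (by linarith)
  have j2 := ii (M * ε + h) η (by linarith) (by linarith)
  have j3 := ii η (η + h) (by linarith) (by linarith)
  have a1 := intervalIntegral.integral_add_adjacent_intervals j1 j2
  have a2 := intervalIntegral.integral_add_adjacent_intervals j2 j3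
  have k1 : |(∫ y in (M * ε)..(M * ε + h), φ y) - h * φ (M * ε)| ≤ 2 * A * (M + 1) * ε * ε := by
    have : (∫ y in (M * ε)..(M * ε + h), φ y) - h * φ (M * ε)
        = ∫ y in (M * ε)..(M * ε + h), (φ y - φ (M * ε)) := by
      rw [intervalIntegral.integral_sub j1 intervalIntegrable_const]; simp
    rw [this, ← Real.norm_eq_abs]
    refine (intervalIntegral.norm_integral_le_of_norm_le_const (C := 2 * A * (M + 1) * ε)
      fun y hy => ?_).trans (by simp [hh])
    have hy' : y ≤ (M + 1) * ε :=
      (uIoc_subset_uIcc hy).2.trans (max_le (by linarith) (by linarith))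
    have p1 := Hr y (by linarith)
    have p2 := Hr (M * ε) (by linarith)
    have m1 : max y 0 ≤ (M + 1) * ε := max_le hy' (by positivity)
    have m2 : max (M * ε) 0 ≤ (M + 1) * ε := max_le (by linarith) (by positivity)
    have q1 : φ y ≤ 2 * A * ((M + 1) * ε) := p1.2.trans (by gcongr)
    have q2 : φ (M * ε) ≤ 2 * A * ((M + 1) * ε) := p2.2.trans (by gcongr)
    rw [Real.norm_eq_abs, abs_le]
    constructor <;> linarith
  have k2 : |(∫ y in η..(η + h), φ y) - h * φ η| ≤ |C| * ε * ε := by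
    have : (∫ y in η..(η + h), φ y) - h * φ η = ∫ y in η..(η + h), (φ y - φ η) := by
      rw [intervalIntegral.integral_sub j3 intervalIntegrable_const]; simp
    rw [this, ← Real.norm_eq_abs]
    refine (intervalIntegral.norm_integral_le_of_norm_le_const (C := |C| * ε)
      fun y hy => ?_).trans (by simp [hh])
    have hy' : |y - η| ≤ ε := by
      have := abs_sub_left_of_mem_uIcc (uIoc_subset_uIcc hy)
      rwa [add_sub_cancel_left, hh] at this
    have := hC (y := y) (by rw [Real.dist_eq]; linarith)
    refine this.trans ?_
    rw [Real.norm_eq_abs]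
    calc C * |y - η| ≤ |C| * |y - η| := by gcongr; exact le_abs_self C
      _ ≤ _ := by gcongr
  have k1 := (abs_le.1 k1).1
  have k2 := (abs_le.1 k2).2
  linarith

/-- The edge contribution to the tangent gap. -/
theorem eventually_integral_tangentGap (hφ : EdgeProfile φ L A) {κ : ℝ} (hκ : 0 < κ) :
    ∃ η M, 0 < η ∧ η < L / 2 ∧ 1 < M ∧ ∀ᶠ ε in 𝓝[>] (0 : ℝ), ∀ h, |h| = ε →
      (A / 2 - κ) * gLog ε ≤ ∫ y in (M * ε)..η, tangentGap φ h y := by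
  have hA := hφ.coeff_pos
  set δ : ℝ := min (1 / 80) (κ / (160 * A)) with hδdef
  have hδ : 0 < δ := lt_min (by norm_num) (by positivity)
  have hδ1 : δ ≤ 1 / 80 := min_le_left _ _
  have hδA : 40 * δ * (2 * A) ≤ κ / 2 := by
    have : δ ≤ κ / (160 * A) := min_le_right _ _
    rw [le_div_iff₀ (by positivity)] at this
    linarith
  obtain ⟨η, hη, hηL, H⟩ := hφ.exists_gap_bound hδ (min_le_left _ _)
  set M : ℝ := 1 / δ with hM
  have hM1 : 1 < M := by rw [hM, lt_div_iff₀ hδ]; linarith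
  have hM0 : 0 < M := by linarith
  obtain ⟨K, hK⟩ := hφ.exists_integral_remainder_ge hη hηL hM1
  refine ⟨η, M, hη, hηL, hM1, ?_⟩
  have hm : 0 < min A (κ / 4) := lt_min hA (by positivity)
  filter_upwards [self_mem_nhdsWithin, eventually_gLog_pos,
    eventually_integral_sq_div hA hδ hη hm,
    eventually_mul_sq_le_gLog K (δ := κ / 4) (by positivity), hK,
    eventually_nhdsGT_zero_lt (c := η / M) (by positivity),
    eventually_nhdsGT_zero_lt (c := L / 2) (by linarith [hφ.length_pos])] with ε hε hg hI hK hR hε2 hε3 h hh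
  have hε : 0 < ε := hε
  have hεM : ε / δ = M * ε := by rw [hM]; ring
  rw [lt_div_iff₀ hM0] at hε2
  have hI := hI h hh
  have hR := hR h hh
  rw [hεM] at hI
  have hle : M * ε ≤ η := by linarith
  have hMε : ε < M * ε := by nlinarith
  have hh' := abs_le.1 hh.le
  have hsub : uIcc (M * ε) η ⊆ Ioo 0 (L - |h|) := by
    rw [uIcc_of_le hle, hh]
    exact fun y hy => ⟨by linarith [hy.1], by linarith [hy.2]⟩
  have hsub' : uIcc (M * ε) η ⊆ Ioo 0 L := hsub.trans (Ioo_subset_Ioo_right (by linarith [abs_nonneg h]))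
  have i1 : IntervalIntegrable (tangentGap φ h) volume (M * ε) η :=
    (hφ.tangentGap_continuousOn.mono hsub).intervalIntegrable
  have i2 : IntervalIntegrable (fun y => φ y - φ (y + h) + h * deriv φ y) volume (M * ε) η := by
    apply ContinuousOn.intervalIntegrable
    refine ((hφ.continuousOn.mono fun y hy => (hsub' hy).2).sub
      (hφ.continuousOn.comp (by fun_prop) fun y hy => ?_)).add (continuousOn_const.mul
      ((hφ.contDiffOn.continuousOn_deriv_of_isOpen isOpen_Ioo le_rfl).mono hsub'))
    have := (hsub hy).2
    simp only [mem_Iio]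
    linarith
  have i3 : IntervalIntegrable (fun y => A * (h ^ 2 / y)) volume (M * ε) η := by
    apply ContinuousOn.intervalIntegrable
    exact continuousOn_const.mul (continuousOn_const.div continuousOn_id fun y hy =>
      (hsub hy).1.ne')
  have mono : (1 / 2 - 40 * δ) * (∫ y in (M * ε)..η, A * (h ^ 2 / y))
      ≤ (∫ y in (M * ε)..η, tangentGap φ h y)
        - ∫ y in (M * ε)..η, (φ y - φ (y + h) + h * deriv φ y) := by
    rw [← intervalIntegral.integral_const_mul, ← intervalIntegral.integral_sub i1 i2]
    refine intervalIntegral.integral_mono_on hle (i3.const_mul _) (i1.sub i2) fun y hy => ?_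
    have hy0 : 0 < y := lt_of_lt_of_le (by positivity) hy.1
    have hhy : |h| ≤ δ * y := by
      rw [hh, ← div_le_iff₀' hδ, hεM]; exact hy.1
    exact (H y hy0 hy.2 h hhy).2
  generalize (∫ y in (M * ε)..η, tangentGap φ h y) = X at *
  generalize (∫ y in (M * ε)..η, (φ y - φ (y + h) + h * deriv φ y)) = Y at *
  generalize (∫ y in (M * ε)..η, A * (h ^ 2 / y)) = Z at *
  have hZ : Z ≤ 2 * A * gLog ε := by
    have := (abs_le.1 hI).2
    have : min A (κ / 4) * gLog ε ≤ A * gLog ε := by gcongr; exact min_le_left _ _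
    linarith
  have hZ2 : |Z - A * gLog ε| ≤ κ / 4 * gLog ε := hI.trans (by gcongr; exact min_le_right _ _)
  have hZ3 := (abs_le.1 hZ2).1
  have e1 : 40 * δ * Z ≤ κ / 2 * gLog ε := by
    calc 40 * δ * Z ≤ 40 * δ * (2 * A * gLog ε) := by gcongr
      _ = 40 * δ * (2 * A) * gLog ε := by ring
      _ ≤ _ := by gcongr
  have := mul_pos hκ hg
  nlinarith

end EdgeProfile

/-! ### From the two edges to the whole density -/

namespace IsIntervalDensity

variable {f : ℝ → ℝ} {a b A₁ A₂ : ℝ}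

theorem nonneg {κ₁ κ₂ : ℝ} (hf : IsIntervalDensity f a b κ₁ κ₂ A₁ A₂) (x : ℝ) : 0 ≤ f x := by
  by_cases hx : x ∈ Ioo a b
  · exact (hf.pos x hx).le
  · rw [hf.zero x hx]

theorem leftProfile (hf : IsIntervalDensity f a b 2 2 A₁ A₂)
    (hconc : ConcaveOn ℝ (Ioo a b) fun x => Real.log (f x)) :
    EdgeProfile (fun y => f (a + y)) (b - a) A₁ where
  length_pos := sub_pos.2 hf.lt
  coeff_pos := hf.coeff_pos.1
  pos y hy := hf.pos _ ⟨by linarith [hy.1], by linarith [hy.2]⟩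
  zero y hy := hf.zero _ fun h => by linarith [h.1]
  contDiffOn := hf.contDiffOn.comp (by fun_prop) fun y hy => ⟨by linarith [hy.1], by linarith [hy.2]⟩
  concave := by
    refine ⟨convex_Ioo _ _, fun x hx y hy p q hp hq hpq => ?_⟩
    have := hconc.2 (x := a + x) (y := a + y) ⟨by linarith [hx.1], by linarith [hx.2]⟩
      ⟨by linarith [hy.1], by linarith [hy.2]⟩ hp hq hpq
    have e : p • (a + x) + q • (a + y) = a + (p • x + q • y) := by
      simp only [smul_eq_mul]
      linear_combination a * hpq
    rwa [e] at this
  edge := by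
    have h1 : Tendsto (fun y : ℝ => a + y) (𝓝[>] 0) (𝓝[>] a) := by
      refine tendsto_nhdsWithin_iff.2 ⟨?_, ?_⟩
      · have : Tendsto (fun y : ℝ => a + y) (𝓝 0) (𝓝 (a + 0)) := Continuous.tendsto (by fun_prop) 0
        rw [add_zero] at this
        exact this.mono_left nhdsWithin_le_nhds
      · filter_upwards [self_mem_nhdsWithin] with y hy
        simpa using hy
    have h2 := hf.left_edge.comp_tendsto h1
    have hA := hf.coeff_pos.1
    have h3 := (Asymptotics.isEquivalent_iff_tendsto_one ?_).1 h2
    · have h4 := h3.const_mul A₁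
      rw [mul_one] at h4
      refine h4.congr' ?_
      filter_upwards [self_mem_nhdsWithin] with y hy
      have hy : 0 < y := hy
      simp only [Pi.div_apply, Function.comp, add_sub_cancel_left]
      norm_num
      field_simp
    · filter_upwards [self_mem_nhdsWithin] with y hy
      have hy : 0 < y := hy
      simp only [Function.comp, add_sub_cancel_left]
      positivity

theorem reflect (hf : IsIntervalDensity f a b 2 2 A₁ A₂) :
    IsIntervalDensity (fun x => f (-x)) (-b) (-a) 2 2 A₂ A₁ where
  lt := neg_lt_neg hf.lt
  pos x hx := hf.pos _ ⟨by linarith [hx.2], by linarith [hx.1]⟩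
  zero x hx := hf.zero _ fun h => hx ⟨by linarith [h.2], by linarith [h.1]⟩
  integral_eq_one := by
    rw [← hf.integral_eq_one]
    exact lintegral_neg_eq_self fun x => ENNReal.ofReal (f x)
  contDiffOn := hf.contDiffOn.comp (by fun_prop) fun y hy => ⟨by linarith [hy.2], by linarith [hy.1]⟩
  kappa_pos := hf.kappa_pos.symm
  coeff_pos := hf.coeff_pos.symm
  left_edge := by
    refine (hf.right_edge.comp_tendsto (tendsto_neg_nhdsGT_neg (a := b))).congr_right ?_
    exact Eventually.of_forall fun x => by simp [add_comm]
  right_edge := by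
    refine (hf.left_edge.comp_tendsto (tendsto_neg_nhdsLT_neg (a := a))).congr_right ?_
    refine Eventually.of_forall fun x => ?_
    simp only [Function.comp]
    rw [show -x - a = -a - x by ring]

theorem reflect_concave (hconc : ConcaveOn ℝ (Ioo a b) fun x => Real.log (f x)) :
    ConcaveOn ℝ (Ioo (-b) (-a)) fun x => Real.log (f (-x)) := by
  refine ⟨convex_Ioo _ _, fun x hx y hy p q hp hq hpq => ?_⟩
  have := hconc.2 (x := -x) (y := -y) ⟨by linarith [hx.2], by linarith [hx.1]⟩
    ⟨by linarith [hy.2], by linarith [hy.1]⟩ hp hq hpq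
  have e : p • (-x) + q • (-y) = -(p • x + q • y) := by simp only [smul_eq_mul]; ring
  rwa [e] at this

theorem rightProfile (hf : IsIntervalDensity f a b 2 2 A₁ A₂)
    (hconc : ConcaveOn ℝ (Ioo a b) fun x => Real.log (f x)) :
    EdgeProfile (fun y => f (b - y)) (b - a) A₂ := by
  have := hf.reflect.leftProfile (reflect_concave hconc)
  rw [show -a - -b = b - a by ring] at this
  convert this using 3
  ring

theorem continuous (hf : IsIntervalDensity f a b 2 2 A₁ A₂)
    (hconc : ConcaveOn ℝ (Ioo a b) fun x => Real.log (f x)) : Continuous f := by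
  have h1 := (hf.leftProfile hconc).continuousOn
  have h2 := (hf.rightProfile hconc).continuousOn
  rw [continuous_iff_continuousAt]
  intro x
  rcases lt_or_ge x b with h | h
  · have : ContinuousAt (fun y => f (a + y)) (x - a) := h1.continuousAt (Iio_mem_nhds (by linarith))
    have := ContinuousAt.comp (g := fun y => f (a + y)) (f := fun x => x - a) this (by fun_prop)
    simpa [Function.comp_def] using this
  · have : ContinuousAt (fun y => f (b - y)) (b - x) :=
      h2.continuousAt (Iio_mem_nhds (by linarith [hf.lt]))
    have := ContinuousAt.comp (g := fun y => f (b - y)) (f := fun x => b - x) this (by fun_prop)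
    simpa [Function.comp_def] using this

theorem hasCompactSupport {κ₁ κ₂ : ℝ} (hf : IsIntervalDensity f a b κ₁ κ₂ A₁ A₂) :
    HasCompactSupport f :=
  HasCompactSupport.intro isCompact_Icc fun x hx =>
    hf.zero x fun h => hx (Ioo_subset_Icc_self h)

theorem integrable (hf : IsIntervalDensity f a b 2 2 A₁ A₂)
    (hconc : ConcaveOn ℝ (Ioo a b) fun x => Real.log (f x)) : Integrable f :=
  (hf.continuous hconc).integrable_of_hasCompactSupport hf.hasCompactSupport

theorem integral_eq (hf : IsIntervalDensity f a b 2 2 A₁ A₂)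
    (hconc : ConcaveOn ℝ (Ioo a b) fun x => Real.log (f x)) : ∫ x, f x = 1 := by
  have := ofReal_integral_eq_lintegral_ofReal (hf.integrable hconc) (ae_of_all _ hf.nonneg)
  rw [hf.integral_eq_one] at this
  exact ENNReal.ofReal_eq_one.1 this

theorem exists_bound (hf : IsIntervalDensity f a b 2 2 A₁ A₂)
    (hconc : ConcaveOn ℝ (Ioo a b) fun x => Real.log (f x)) : ∃ B, 0 < B ∧ ∀ x, f x ≤ B := by
  obtain ⟨C, hC⟩ := (hf.continuous hconc).bounded_above_of_compact_support hf.hasCompactSupport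
  exact ⟨max C 1, by positivity, fun x => (le_abs_self _).trans ((hC x).trans (le_max_left _ _))⟩

theorem differentiableAt {κ₁ κ₂ : ℝ} (hf : IsIntervalDensity f a b κ₁ κ₂ A₁ A₂) {x : ℝ}
    (hx : x ∈ Ioo a b) : DifferentiableAt ℝ f x :=
  (hf.contDiffOn.differentiableOn (by norm_num)).differentiableAt (isOpen_Ioo.mem_nhds hx)

theorem hasDerivAt_log {κ₁ κ₂ : ℝ} (hf : IsIntervalDensity f a b κ₁ κ₂ A₁ A₂) {x : ℝ}
    (hx : x ∈ Ioo a b) : HasDerivAt (fun x => Real.log (f x)) (deriv f x / f x) x :=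
  (hf.differentiableAt hx).hasDerivAt.log (hf.pos x hx).ne'

theorem log_le_tangent {κ₁ κ₂ : ℝ} (hf : IsIntervalDensity f a b κ₁ κ₂ A₁ A₂)
    (hconc : ConcaveOn ℝ (Ioo a b) fun x => Real.log (f x)) {x y : ℝ}
    (hx : x ∈ Ioo a b) (hy : y ∈ Ioo a b) :
    Real.log (f y) ≤ Real.log (f x) + (y - x) * (deriv f x / f x) :=
  ConcaveOn.le_tangent hconc hx hy (hf.hasDerivAt_log hx)

theorem geomMean_continuous (hf : IsIntervalDensity f a b 2 2 A₁ A₂)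
    (hconc : ConcaveOn ℝ (Ioo a b) fun x => Real.log (f x)) {s : ℝ} (hs : s ∈ Ioo (0 : ℝ) 1) (h : ℝ) :
    Continuous fun y => f (y + h) ^ s * f y ^ (1 - s) := by
  have hc := hf.continuous hconc
  exact ((hc.comp (by fun_prop : Continuous fun y => y + h)).rpow_const fun _ => Or.inr hs.1.le).mul
    (hc.rpow_const fun _ => Or.inr (sub_nonneg.2 hs.2.le))

theorem geomMean_integrable (hf : IsIntervalDensity f a b 2 2 A₁ A₂)
    (hconc : ConcaveOn ℝ (Ioo a b) fun x => Real.log (f x)) {s : ℝ} (hs : s ∈ Ioo (0 : ℝ) 1) (h : ℝ) :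
    Integrable fun y => f (y + h) ^ s * f y ^ (1 - s) :=
  (hf.geomMean_continuous hconc hs h).integrable_of_hasCompactSupport
    (HasCompactSupport.intro (K := Icc a b) isCompact_Icc fun x hx => by
      rw [hf.zero x fun h => hx (Ioo_subset_Icc_self h),
        Real.zero_rpow (sub_pos.2 hs.2).ne', mul_zero])

theorem meanGap_integrable (hf : IsIntervalDensity f a b 2 2 A₁ A₂)
    (hconc : ConcaveOn ℝ (Ioo a b) fun x => Real.log (f x)) {s : ℝ} (hs : s ∈ Ioo (0 : ℝ) 1) (h : ℝ) :
    Integrable (meanGap f s h) := by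
  have hi := hf.integrable hconc
  exact (((hi.comp_add_right h).const_mul s).add (hi.const_mul (1 - s))).sub
    (hf.geomMean_integrable hconc hs h)

theorem integral_geomMean (hf : IsIntervalDensity f a b 2 2 A₁ A₂)
    (hconc : ConcaveOn ℝ (Ioo a b) fun x => Real.log (f x)) {s : ℝ} (hs : s ∈ Ioo (0 : ℝ) 1) (h : ℝ) :
    ∫ y, f (y + h) ^ s * f y ^ (1 - s) = 1 - ∫ y, meanGap f s h y := by
  have hi := hf.integrable hconc
  have hadd : Integrable fun y => s * f (y + h) + (1 - s) * f y :=
    ((hi.comp_add_right h).const_mul s).add (hi.const_mul (1 - s))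
  unfold meanGap
  rw [integral_sub hadd
    (hf.geomMean_integrable hconc hs h), integral_add ((hi.comp_add_right h).const_mul s)
    (hi.const_mul (1 - s)), integral_const_mul, integral_const_mul,
    integral_add_right_eq_self (fun x => f x) h, hf.integral_eq hconc]
  ring

/-- In the interior the gap is quadratic in the shift. -/
theorem exists_meanGap_le_sq (hf : IsIntervalDensity f a b 2 2 A₁ A₂)
    (hconc : ConcaveOn ℝ (Ioo a b) fun x => Real.log (f x)) {c d : ℝ} (hc : a < c) (hd : d < b) :
    ∃ K, 0 ≤ K ∧ ∀ᶠ ε in 𝓝[>] (0 : ℝ), ∀ s ∈ Ioo (0 : ℝ) 1, ∀ y ∈ Icc c d,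
      meanGap f s ε y ≤ K * ε ^ 2 := by
  obtain ⟨B, hB, hfB⟩ := hf.exists_bound hconc
  -- The midpoint leaves room for y + ε inside a compact interval on which the score f'/f is
  -- bounded.
  set d' := (d + b) / 2 with hd'
  have hsub : Icc c d' ⊆ Ioo a b := fun y hy => ⟨by linarith [hy.1], by linarith [hy.2]⟩
  have hcont : ContinuousOn (fun y => deriv f y / f y) (Icc c d') :=
    ((hf.contDiffOn.continuousOn_deriv_of_isOpen isOpen_Ioo le_rfl).mono hsub).div
      (hf.continuous hconc).continuousOn fun y hy => (hf.pos y (hsub hy)).ne'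
  obtain ⟨C, hC⟩ := isCompact_Icc.exists_bound_of_continuousOn hcont
  refine ⟨B * (2 * C ^ 2), by positivity, ?_⟩
  filter_upwards [self_mem_nhdsWithin, eventually_nhdsGT_zero_lt (c := (b - d) / 2) (by linarith),
    eventually_nhdsGT_zero_lt (c := 1 / (|C| + 1)) (by positivity)] with ε hε h1 h2 s hs y hy
  have hε : 0 < ε := hε
  have hy1 : y ∈ Icc c d' := ⟨hy.1, by linarith [hy.2]⟩
  have hy2 : y + ε ∈ Icc c d' := ⟨by linarith [hy.1], by linarith [hy.2]⟩
  have t1 := hf.log_le_tangent hconc (hsub hy1) (hsub hy2)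
  have t2 := hf.log_le_tangent hconc (hsub hy2) (hsub hy1)
  have hC0 : 0 ≤ C := (norm_nonneg _).trans (hC y hy1)
  have b1 := (abs_le.1 (hC y hy1)).2
  have b2 := (abs_le.1 (hC _ hy2)).1
  rw [meanGap_eq (hf.pos y (hsub hy1)) (hf.pos _ (hsub hy2))]
  have hu : |Real.log (f (y + ε)) - Real.log (f y)| ≤ C * ε := by
    rw [abs_le]
    constructor <;> nlinarith
  generalize Real.log (f (y + ε)) - Real.log (f y) = u at *
  rw [lt_div_iff₀ (by positivity), abs_of_nonneg hC0] at h2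
  have hu1 : |u| ≤ 1 := by linarith
  have hg := (abs_le.1 (abs_mean_gap_le hs hu1)).2
  have h3 : |u| ^ 3 ≤ u ^ 2 := by
    rw [← sq_abs u]; exact pow_le_pow_of_le_one (abs_nonneg u) hu1 (by norm_num)
  have h4 : s * (1 - s) ≤ 1 := by nlinarith [sq_nonneg (s - 1 / 2)]
  have h5 : u ^ 2 ≤ (C * ε) ^ 2 := by rw [← sq_abs u]; gcongr
  have h6 : s * (1 - s) * (u ^ 2 / 2) ≤ 1 * (u ^ 2 / 2) := by gcongr
  calc _ ≤ f y * (2 * C ^ 2 * ε ^ 2) := by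
        have := (hf.nonneg y)
        gcongr
        linarith [sq_nonneg u, mul_pow C ε 2]
    _ ≤ B * (2 * C ^ 2 * ε ^ 2) := by have := hfB y; gcongr
    _ = _ := by ring

/-- The expansion of the gap between `1` and the Hellinger affinities, uniformly in the order. -/
theorem eventually_integral_meanGap (hf : IsIntervalDensity f a b 2 2 A₁ A₂)
    (hconc : ConcaveOn ℝ (Ioo a b) fun x => Real.log (f x)) {κ : ℝ} (hκ : 0 < κ) :
    ∀ᶠ ε in 𝓝[>] (0 : ℝ), ∀ s ∈ Ioo (0 : ℝ) 1,
      |(∫ y, meanGap f s ε y) - s * (1 - s) * ((A₁ + A₂) / 2) * gLog ε| ≤ κ * gLog ε := by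
  obtain ⟨η₁, hη₁, hL₁, H₁⟩ := (hf.leftProfile hconc).eventually_integral_meanGap
    (show 0 < κ / 3 by positivity)
  obtain ⟨η₂, hη₂, hL₂, H₂⟩ := (hf.rightProfile hconc).eventually_integral_meanGap
    (show 0 < κ / 3 by positivity)
  obtain ⟨K, hK0, hK⟩ := hf.exists_meanGap_le_sq hconc (c := a + η₁) (d := b - η₂) (by linarith)
    (by linarith)
  filter_upwards [H₁, H₂, hK, self_mem_nhdsWithin,
    eventually_mul_sq_le_gLog (K * (b - a)) (show 0 < κ / 3 by positivity)]
    with ε h1 h2 h3 hε h4 s hs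
  have hε : 0 < ε := hε
  have h1 := h1 ε (abs_of_pos hε) s hs
  have h2 := h2 (-ε) (by rw [abs_neg, abs_of_pos hε]) s hs
  have hint := hf.meanGap_integrable hconc hs ε
  have ii : ∀ c d, IntervalIntegrable (meanGap f s ε) volume c d := fun c d =>
    hint.intervalIntegrable
  -- The line is cut into the two edges and the interior. The edges reach out to a - ε and b + ε,
  -- outside of which both densities vanish.
  have e0 : ∫ y, meanGap f s ε y = ∫ y in (a - ε)..(b + ε), meanGap f s ε y := by
    symm
    apply intervalIntegral.integral_eq_integral_of_support_subset
    intro y hy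
    by_contra hy'
    apply hy
    rw [mem_Ioc, not_and_or, not_lt, not_le] at hy'
    have z1 : f y = 0 := hf.zero y fun h => by rcases hy' with h' | h' <;> linarith [h.1, h.2]
    have z2 : f (y + ε) = 0 := hf.zero _ fun h => by rcases hy' with h' | h' <;> linarith [h.1, h.2]
    unfold meanGap
    rw [z1, z2, Real.zero_rpow hs.1.ne']
    ring
  have e1 : (∫ y in (-ε)..η₁, meanGap (fun y => f (a + y)) s ε y)
      = ∫ y in (a - ε)..(a + η₁), meanGap f s ε y := by
    rw [sub_eq_add_neg, ← intervalIntegral.integral_comp_add_left (fun y => meanGap f s ε y)]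
    simp only [meanGap, add_assoc]
  have e2 : (∫ y in (-ε)..η₂, meanGap (fun y => f (b - y)) s (-ε) y)
      = ∫ y in (b - η₂)..(b + ε), meanGap f s ε y := by
    rw [show b + ε = b - -ε by ring,
      ← intervalIntegral.integral_comp_sub_left (fun y => meanGap f s ε y)]
    congr 1; ext y
    simp only [meanGap]
    rw [show b - (y + -ε) = b - y + ε by ring]
  have hle : a + η₁ ≤ b - η₂ := by linarith
  have e3 : |∫ y in (a + η₁)..(b - η₂), meanGap f s ε y| ≤ κ / 3 * gLog ε := by
    rw [← Real.norm_eq_abs]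
    refine (intervalIntegral.norm_integral_le_of_norm_le_const (C := K * ε ^ 2)
      fun y hy => ?_).trans ?_
    · rw [uIoc_of_le hle] at hy
      rw [Real.norm_eq_abs, abs_of_nonneg (meanGap_nonneg hf.nonneg hs _ _)]
      exact h3 s hs y ⟨hy.1.le, hy.2⟩
    · rw [abs_of_nonneg (sub_nonneg.2 hle)]
      calc _ ≤ K * ε ^ 2 * (b - a) := by gcongr <;> linarith
        _ = K * (b - a) * ε ^ 2 := by ring
        _ ≤ _ := h4
  rw [e1] at h1
  rw [e2] at h2
  rw [e0, ← intervalIntegral.integral_add_adjacent_intervals (ii (a - ε) (b - η₂)) (ii _ (b + ε)),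
    ← intervalIntegral.integral_add_adjacent_intervals (ii (a - ε) (a + η₁)) (ii _ (b - η₂))]
  rw [abs_le] at *
  constructor <;> linarith [h1.1, h1.2, h2.1, h2.2, e3.1, e3.2]

/-- The tangent line of log f lies above its graph; off the support the left side is zero. So
`tangentGap` is nonnegative on (a, b), and the score moment is integrable for either sign of h. -/
theorem tangent_le (hf : IsIntervalDensity f a b 2 2 A₁ A₂)
    (hconc : ConcaveOn ℝ (Ioo a b) fun x => Real.log (f x)) {y : ℝ} (hy : y ∈ Ioo a b) (h : ℝ) :
    f (y + h) * Real.exp (-(h * (deriv f y / f y))) ≤ f y := by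
  by_cases hy' : y + h ∈ Ioo a b
  · have t := hf.log_le_tangent hconc hy hy'
    rw [add_sub_cancel_left] at t
    conv_lhs => rw [← Real.exp_log (hf.pos _ hy'), ← Real.exp_add]
    conv_rhs => rw [← Real.exp_log (hf.pos _ hy)]
    exact Real.exp_le_exp.2 (by linarith)
  · rw [hf.zero _ hy', zero_mul]
    exact hf.nonneg y

theorem tangent_integrableOn (hf : IsIntervalDensity f a b 2 2 A₁ A₂)
    (hconc : ConcaveOn ℝ (Ioo a b) fun x => Real.log (f x)) (h : ℝ) :
    IntegrableOn (fun y => f (y + h) * Real.exp (-(h * (deriv f y / f y)))) (Ioo a b) := by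
  have hm := (hf.continuous hconc).measurable
  refine (hf.integrable hconc).integrableOn.mono' ?_ ?_
  · have h1 : Measurable fun y => f (y + h) := hm.comp (by fun_prop)
    have h2 := measurable_deriv f
    exact (h1.mul (((h2.div hm).const_mul h).neg.exp)).aestronglyMeasurable
  · filter_upwards [ae_restrict_mem measurableSet_Ioo] with y hy
    rw [Real.norm_eq_abs, abs_of_nonneg (mul_nonneg (hf.nonneg _) (Real.exp_pos _).le)]
    exact hf.tangent_le hconc hy h

theorem setIntegral_eq (hf : IsIntervalDensity f a b 2 2 A₁ A₂)
    (hconc : ConcaveOn ℝ (Ioo a b) fun x => Real.log (f x)) : ∫ x in Ioo a b, f x = 1 := by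
  rw [setIntegral_eq_integral_of_forall_compl_eq_zero fun x hx => hf.zero x hx, hf.integral_eq hconc]

/-- The exponential moment of the score of the shifted density. -/
theorem eventually_integral_tangent_le (hf : IsIntervalDensity f a b 2 2 A₁ A₂)
    (hconc : ConcaveOn ℝ (Ioo a b) fun x => Real.log (f x)) {κ : ℝ} (hκ : 0 < κ) :
    ∀ᶠ ε in 𝓝[>] (0 : ℝ), ∀ h, |h| = ε →
      ∫ y in Ioo a b, f (y + h) * Real.exp (-(h * (deriv f y / f y)))
        ≤ 1 - ((A₁ + A₂) / 2 - κ) * gLog ε := by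
  obtain ⟨η₁, M₁, hη₁, hL₁, hM₁, H₁⟩ := (hf.leftProfile hconc).eventually_integral_tangentGap
    (show 0 < κ / 2 by positivity)
  obtain ⟨η₂, M₂, hη₂, hL₂, hM₂, H₂⟩ := (hf.rightProfile hconc).eventually_integral_tangentGap
    (show 0 < κ / 2 by positivity)
  filter_upwards [H₁, H₂, self_mem_nhdsWithin,
    eventually_nhdsGT_zero_lt (c := η₁ / M₁) (by positivity),
    eventually_nhdsGT_zero_lt (c := η₂ / M₂) (by positivity)] with ε h1 h2 hε h3 h4 h hh
  have hε : 0 < ε := hε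
  rw [lt_div_iff₀ (by positivity)] at h3 h4
  have h1 := h1 h hh
  have h2 := h2 (-h) (by rwa [abs_neg])
  have hM1 : 0 < M₁ * ε := by positivity
  have hM2 : 0 < M₂ * ε := by positivity
  have hint : IntegrableOn (tangentGap f h) (Ioo a b) :=
    (hf.integrable hconc).integrableOn.sub (hf.tangent_integrableOn hconc h)
  have e0 : ∫ y in Ioo a b, f (y + h) * Real.exp (-(h * (deriv f y / f y)))
      = 1 - ∫ y in Ioo a b, tangentGap f h y := by
    unfold tangentGap
    rw [integral_sub (hf.integrable hconc).integrableOn (hf.tangent_integrableOn hconc h),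
      hf.setIntegral_eq hconc]
    ring
  have e1 : (∫ y in (M₁ * ε)..η₁, tangentGap (fun y => f (a + y)) h y)
      = ∫ y in Ioc (a + M₁ * ε) (a + η₁), tangentGap f h y := by
    rw [← intervalIntegral.integral_of_le (by linarith),
      ← intervalIntegral.integral_comp_add_left (fun y => tangentGap f h y)]
    simp only [tangentGap, add_assoc, deriv_comp_const_add]
  have e2 : (∫ y in (M₂ * ε)..η₂, tangentGap (fun y => f (b - y)) (-h) y)
      = ∫ y in Ioc (b - η₂) (b - M₂ * ε), tangentGap f h y := by
    rw [← intervalIntegral.integral_of_le (by linarith),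
      ← intervalIntegral.integral_comp_sub_left (fun y => tangentGap f h y)]
    congr 1; ext y
    simp only [tangentGap, deriv_comp_const_sub]
    rw [show b - (y + -h) = b - y + h by ring, show -h * (-deriv f (b - y) / f (b - y))
      = h * (deriv f (b - y) / f (b - y)) by ring]
  rw [e1] at h1
  rw [e2] at h2
  have hs1 : Ioc (a + M₁ * ε) (a + η₁) ⊆ Ioo a b := fun y hy =>
    ⟨by linarith [hy.1], by linarith [hy.2]⟩
  have hs2 : Ioc (b - η₂) (b - M₂ * ε) ⊆ Ioo a b := fun y hy =>
    ⟨by linarith [hy.1], by linarith [hy.2]⟩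
  have hdisj : Disjoint (Ioc (a + M₁ * ε) (a + η₁)) (Ioc (b - η₂) (b - M₂ * ε)) :=
    Set.disjoint_left.2 fun y hy hy' => by linarith [hy.2, hy'.1]
  have hun := setIntegral_union hdisj measurableSet_Ioc (hint.mono_set hs1) (hint.mono_set hs2)
  -- Only a lower bound is needed, so by nonnegativity everything outside the two edge intervals is
  -- dropped.
  have hmono := setIntegral_mono_set hint
    ((ae_restrict_iff' measurableSet_Ioo).2 (ae_of_all _ fun y hy =>
      sub_nonneg.2 (hf.tangent_le hconc hy h)))
    (union_subset hs1 hs2).eventuallyLE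
  rw [e0]
  linarith

end IsIntervalDensity

/-! ### Rényi entropies and the closed-form bounds -/

/-- The Hellinger affinity `∫ f(y+h)^s f(y)^(1-s) dy` of order `s`. -/
def affinity (f : ℝ → ℝ) (s h : ℝ) : ℝ := ∫ y, f (y + h) ^ s * f y ^ (1 - s)

namespace IsIntervalDensity

variable {f : ℝ → ℝ} {a b A₁ A₂ : ℝ}

theorem lintegral_shift_eq (hf : IsIntervalDensity f a b 2 2 A₁ A₂)
    (hconc : ConcaveOn ℝ (Ioo a b) fun x => Real.log (f x)) {s : ℝ} (hs : s ∈ Ioo (0 : ℝ) 1)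
    (θ₁ θ₂ : ℝ) :
    ∫⁻ x, ENNReal.ofReal (shiftFamily f θ₁ x ^ s * shiftFamily f θ₂ x ^ (1 - s))
      = ENNReal.ofReal (affinity f s (θ₂ - θ₁)) := by
  rw [affinity, ofReal_integral_eq_lintegral_ofReal (hf.geomMean_integrable hconc hs _)
    (ae_of_all _ fun y => mul_nonneg (Real.rpow_nonneg (hf.nonneg _) _)
      (Real.rpow_nonneg (hf.nonneg _) _)),
    ← lintegral_sub_right_eq_self (fun y => ENNReal.ofReal (f (y + (θ₂ - θ₁)) ^ s * f y ^ (1 - s))) θ₂]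
  simp only [shiftFamily]
  congr 1; ext x
  rw [show x - θ₂ + (θ₂ - θ₁) = x - θ₁ by ring]

theorem renyi_shift (hf : IsIntervalDensity f a b 2 2 A₁ A₂)
    (hconc : ConcaveOn ℝ (Ioo a b) fun x => Real.log (f x)) {s : ℝ} (hs : s ∈ Ioo (0 : ℝ) 1)
    (θ ε : ℝ) (hpos : 0 < affinity f s ε) :
    renyi s (shiftFamily f (θ - ε / 2)) (shiftFamily f (θ + ε / 2))
      = ((-Real.log (affinity f s ε) : ℝ) : EReal) := by
  unfold renyi
  rw [hf.lintegral_shift_eq hconc hs, show θ + ε / 2 - (θ - ε / 2) = ε by ring,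
    ENNReal.log_ofReal_of_pos hpos, EReal.coe_neg]

theorem abs_neg_log_one_sub_le {D : ℝ} (h1 : D ≤ 1 / 2) :
    |-Real.log (1 - D) - D| ≤ 2 * D ^ 2 := by
  have hp : 0 < 1 - D := by linarith
  have l1 := Real.log_le_sub_one_of_pos hp
  have l2 := Real.one_sub_inv_le_log_of_pos hp
  have l3 : (1 - D)⁻¹ ≤ 1 + D + 2 * D ^ 2 := by
    rw [inv_le_iff_one_le_mul₀ hp]
    nlinarith [mul_nonneg (sq_nonneg D) (sub_nonneg.2 h1)]
  rw [abs_le]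
  constructor <;> nlinarith [sq_nonneg D]

/-- The Rényi entropies of the shift family, uniformly in the order. -/
theorem eventually_neg_log_affinity (hf : IsIntervalDensity f a b 2 2 A₁ A₂)
    (hconc : ConcaveOn ℝ (Ioo a b) fun x => Real.log (f x)) {κ : ℝ} (hκ : 0 < κ) :
    ∀ᶠ ε in 𝓝[>] (0 : ℝ), ∀ s ∈ Ioo (0 : ℝ) 1, 0 < affinity f s ε ∧
      |-Real.log (affinity f s ε) - s * (1 - s) * ((A₁ + A₂) / 2) * gLog ε| ≤ κ * gLog ε := by
  set c := (A₁ + A₂) / 2 with hc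
  have hc0 : 0 < c := by have := hf.coeff_pos; linarith [this.1, this.2]
  -- With D = 1 - affinity ≤ (c+κ) g, these smallness conditions give D ≤ 1/2 and 2D² ≤ (κ/2) g, the
  -- error of replacing -log(1 - D) by D.
  have hs1 : ∀ᶠ ε in 𝓝[>] (0 : ℝ), gLog ε < 1 / (2 * (c + κ)) :=
    tendsto_gLog_zero.eventually_lt_const (by positivity)
  have hs2 : ∀ᶠ ε in 𝓝[>] (0 : ℝ), gLog ε < κ / (4 * (c + κ) ^ 2) :=
    tendsto_gLog_zero.eventually_lt_const (by positivity)
  filter_upwards [hf.eventually_integral_meanGap hconc (show 0 < κ / 2 by positivity),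
    eventually_gLog_pos, hs1, hs2] with ε h1 hg h2 h3 s hs
  have h1 := h1 s hs
  rw [← hc] at h1
  rw [lt_div_iff₀ (by positivity)] at h2 h3
  have hD0 : 0 ≤ ∫ y, meanGap f s ε y := integral_nonneg (meanGap_nonneg hf.nonneg hs ε)
  rw [affinity, hf.integral_geomMean hconc hs]
  generalize (∫ y, meanGap f s ε y) = D at *
  have hs4 : s * (1 - s) ≤ 1 := by nlinarith [sq_nonneg (s - 1 / 2)]
  have hle : s * (1 - s) * c * gLog ε ≤ 1 * c * gLog ε := by gcongr
  have hD : D ≤ (c + κ) * gLog ε := by nlinarith [(abs_le.1 h1).2]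
  have hD1 : D ≤ 1 / 2 := by linarith
  refine ⟨by linarith, ?_⟩
  have h5 := abs_neg_log_one_sub_le hD1
  have h6 : 2 * D ^ 2 ≤ κ / 2 * gLog ε := by
    calc 2 * D ^ 2 ≤ 2 * ((c + κ) * gLog ε) ^ 2 := by gcongr
      _ = (gLog ε * (4 * (c + κ) ^ 2)) * (gLog ε / 2) := by ring
      _ ≤ κ * (gLog ε / 2) := by gcongr
      _ = _ := by ring
  rw [abs_le] at *
  constructor <;> linarith [h1.1, h1.2, h5.1, h5.2]

theorem eventually_renyiQuotient (hf : IsIntervalDensity f a b 2 2 A₁ A₂)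
    (hconc : ConcaveOn ℝ (Ioo a b) fun x => Real.log (f x)) (θ : ℝ) {κ : ℝ} (hκ : 0 < κ) :
    ∀ᶠ ε in 𝓝[>] (0 : ℝ), ∀ s ∈ Ioo (0 : ℝ) 1, ∃ r : ℝ,
      renyiQuotient (shiftFamily f) gLog θ s ε = (r : EReal) ∧
      |r - s * (1 - s) * ((A₁ + A₂) / 2)| ≤ κ := by
  filter_upwards [hf.eventually_neg_log_affinity hconc hκ, eventually_gLog_pos] with ε h hg s hs
  obtain ⟨h1, h2⟩ := h s hs
  refine ⟨-Real.log (affinity f s ε) / gLog ε, ?_, ?_⟩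
  · rw [renyiQuotient, hf.renyi_shift hconc hs θ ε h1, EReal.coe_div]
  · have : -Real.log (affinity f s ε) / gLog ε - s * (1 - s) * ((A₁ + A₂) / 2)
        = (-Real.log (affinity f s ε) - s * (1 - s) * ((A₁ + A₂) / 2) * gLog ε) / gLog ε := by
      field_simp
    rwa [this, abs_div, abs_of_pos hg, div_le_iff₀ hg]

theorem renyiLimit_eq (hf : IsIntervalDensity f a b 2 2 A₁ A₂)
    (hconc : ConcaveOn ℝ (Ioo a b) fun x => Real.log (f x)) (θ : ℝ) {s : ℝ}
    (hs : s ∈ Ioo (0 : ℝ) 1) :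
    renyiLimit (shiftFamily f) gLog θ s = ((s * (1 - s) * ((A₁ + A₂) / 2) : ℝ) : EReal) := by
  refine Tendsto.limUnder_eq ?_
  have h1 : Tendsto (fun ε => (renyiQuotient (shiftFamily f) gLog θ s ε).toReal) (𝓝[>] 0)
      (𝓝 (s * (1 - s) * ((A₁ + A₂) / 2))) := by
    refine Metric.tendsto_nhds.2 fun κ hκ => ?_
    filter_upwards [hf.eventually_renyiQuotient hconc θ (half_pos hκ)] with ε h
    obtain ⟨r, hr, hr'⟩ := h s hs
    rw [hr, EReal.toReal_coe, Real.dist_eq]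
    linarith
  refine (EReal.tendsto_coe.2 h1).congr' ?_
  filter_upwards [hf.eventually_renyiQuotient hconc θ one_pos] with ε h
  obtain ⟨r, hr, -⟩ := h s hs
  rw [hr, EReal.toReal_coe]

theorem renyiConvergesUniformly (hf : IsIntervalDensity f a b 2 2 A₁ A₂)
    (hconc : ConcaveOn ℝ (Ioo a b) fun x => Real.log (f x)) (θ : ℝ) :
    RenyiConvergesUniformly (shiftFamily f) gLog θ := by
  intro δ hδ
  filter_upwards [hf.eventually_renyiQuotient hconc θ hδ] with ε h s hs
  obtain ⟨r, hr, hr'⟩ := h s hs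
  rw [hr, hf.renyiLimit_eq hconc θ hs, ← EReal.coe_sub, ← EReal.coe_add, EReal.coe_le_coe_iff,
    EReal.coe_le_coe_iff]
  rw [abs_le] at hr'
  constructor <;> linarith [hr'.1, hr'.2]

theorem alphaBar1_eq (hf : IsIntervalDensity f a b 2 2 A₁ A₂)
    (hconc : ConcaveOn ℝ (Ioo a b) fun x => Real.log (f x)) (θ : ℝ) :
    alphaBar1 (shiftFamily f) gLog 2 θ = (((A₁ + A₂) / 2 : ℝ) : EReal) := by
  have hc : 0 < (A₁ + A₂) / 2 := by have := hf.coeff_pos; linarith [this.1, this.2]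
  have hsup : (⨆ s ∈ Ioo (0 : ℝ) 1, renyiLimit (shiftFamily f) gLog θ s)
      = (((A₁ + A₂) / 2 / 4 : ℝ) : EReal) := by
    apply le_antisymm
    · refine iSup₂_le fun s hs => ?_
      rw [hf.renyiLimit_eq hconc θ hs, EReal.coe_le_coe_iff]
      nlinarith [mul_nonneg (sq_nonneg (s - 1 / 2)) hc.le]
    · refine le_iSup₂_of_le (1 / 2 : ℝ) ⟨by norm_num, by norm_num⟩ ?_
      rw [hf.renyiLimit_eq hconc θ ⟨by norm_num, by norm_num⟩, EReal.coe_le_coe_iff]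
      linarith
  rw [alphaBar1, hsup, ← EReal.coe_mul, Real.rpow_two]
  congr 1; ring

/-- At κ = 2 the weight is 1/(s(1-s)), which cancels the factor s(1-s) of the Rényi limit; the
infimum is over a constant. -/
theorem alphaBar2_eq (hf : IsIntervalDensity f a b 2 2 A₁ A₂)
    (hconc : ConcaveOn ℝ (Ioo a b) fun x => Real.log (f x)) (θ : ℝ) :
    alphaBar2 (shiftFamily f) gLog 2 θ = (((A₁ + A₂) / 2 : ℝ) : EReal) := by
  have key : ∀ s ∈ Ioo (0 : ℝ) 1, (weight 2 s : EReal) * renyiLimit (shiftFamily f) gLog θ s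
      = (((A₁ + A₂) / 2 : ℝ) : EReal) := by
    intro s hs
    have hw : weight 2 s = 1 / (s * (1 - s)) := by
      unfold weight
      norm_num
    have h1 := hs.1.ne'
    have h2 := (sub_pos.2 hs.2).ne'
    rw [hf.renyiLimit_eq hconc θ hs, ← EReal.coe_mul, hw]
    congr 1; field_simp
  unfold alphaBar2
  rw [if_neg (by norm_num), if_neg (by norm_num)]
  apply le_antisymm
  · refine iInf₂_le_of_le (1 / 2 : ℝ) ⟨by norm_num, by norm_num⟩ ?_
    rw [key _ ⟨by norm_num, by norm_num⟩]
  · exact le_iInf₂ fun s hs => (key s hs).ge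

end IsIntervalDensity

/-! ### Product laws and the two-point testing bound -/

theorem lintegral_pi_prod_eq_prod (n : ℕ) {μ : Fin n → Measure ℝ} [∀ i, SigmaFinite (μ i)]
    {F : Fin n → ℝ → ℝ≥0∞} (hF : ∀ i, Measurable (F i)) :
    ∫⁻ x, ∏ i, F i (x i) ∂(Measure.pi μ) = ∏ i, ∫⁻ x, F i x ∂(μ i) := by
  induction n with
  | zero => simp
  | succ n ih =>
    have h1 : Measurable fun x : Fin n → ℝ => ∏ i : Fin n, F i.succ (x i) :=
      Finset.measurable_fun_prod _ fun i _ => (hF i.succ).comp (measurable_pi_apply i)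
    rw [Fin.prod_univ_succ, ← ih fun i => hF i.succ,
      ← lintegral_prod_mul (hF 0).aemeasurable h1.aemeasurable,
      ← ((measurePreserving_piFinSuccAbove μ 0).symm).lintegral_comp_emb
        (MeasurableEquiv.measurableEmbedding _)]
    simp [MeasurableEquiv.piFinSuccAbove_symm_apply, Fin.insertNthEquiv, Fin.prod_univ_succ]

theorem iidLaw_eq_withDensity {q : ℝ → ℝ} (hq : Measurable q)
    (h1 : ∫⁻ x, ENNReal.ofReal (q x) ≠ ∞) (n : ℕ) :
    iidLaw q n = (volume : Measure (Fin n → ℝ)).withDensity fun x => ∏ i, ENNReal.ofReal (q (x i)) := by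
  have : IsFiniteMeasure ((volume : Measure ℝ).withDensity fun x => ENNReal.ofReal (q x)) :=
    isFiniteMeasure_withDensity h1
  refine Measure.pi_eq fun s hs => ?_
  rw [withDensity_apply _ (MeasurableSet.univ_pi hs), ← lintegral_indicator (MeasurableSet.univ_pi hs)]
  have e : (indicator (univ.pi s) fun x : Fin n → ℝ => ∏ i, ENNReal.ofReal (q (x i)))
      = fun x => ∏ i, indicator (s i) (fun x => ENNReal.ofReal (q x)) (x i) := by
    ext x
    by_cases hx : x ∈ univ.pi s
    · rw [indicator_of_mem hx]
      exact Finset.prod_congr rfl fun i _ => (indicator_of_mem (hx i (mem_univ i)) fun x => ENNReal.ofReal (q x)).symm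
    · rw [indicator_of_notMem hx]
      simp only [mem_univ_pi, not_forall] at hx
      obtain ⟨i, hi⟩ := hx
      exact (Finset.prod_eq_zero (Finset.mem_univ i) (indicator_of_notMem hi _)).symm
  rw [e, volume_pi, lintegral_pi_prod_eq_prod n fun i => hq.ennreal_ofReal.indicator (hs i)]
  refine Finset.prod_congr rfl fun i _ => ?_
  rw [lintegral_indicator (hs i), withDensity_apply _ (hs i)]

/-- A set on which the likelihood is dominated by a product has exponentially small probability. -/
theorem iidLaw_le_pow {q : ℝ → ℝ} (hq : Measurable q) (h1 : ∫⁻ x, ENNReal.ofReal (q x) ≠ ∞) {n : ℕ}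
    {E : Set (Fin n → ℝ)} (hE : MeasurableSet E) {F : ℝ → ℝ≥0∞} (hF : Measurable F)
    (h : ∀ x ∈ E, ∏ i, ENNReal.ofReal (q (x i)) ≤ ∏ i, F (x i)) :
    iidLaw q n E ≤ (∫⁻ x, F x) ^ n := by
  rw [iidLaw_eq_withDensity hq h1, withDensity_apply _ hE]
  calc _ ≤ ∫⁻ x in E, ∏ i, F (x i) := setLIntegral_mono' hE h
    _ ≤ ∫⁻ x : Fin n → ℝ, ∏ i, F (x i) := setLIntegral_le_lintegral _ _
    _ = _ := by
      rw [volume_pi, lintegral_pi_prod_eq_prod n fun _ => hF]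
      simp

/-- If |log(P/Q)| ≤ l, the geometric mean is at most exp(l/2) min(P,Q). Otherwise moving the
exponent by t toward the larger of P and Q gains a factor exp(lt). Integrated over the sample space,
this bounds testing errors below by affinities of orders 1/2 and 1/2 ± t. -/
theorem sqrt_mul_le {P Q l t : ℝ} (hP : 0 ≤ P) (hQ : 0 ≤ Q) (ht : 0 < t) :
    P ^ (1 / 2 : ℝ) * Q ^ (1 - 1 / 2 : ℝ) ≤ Real.exp (l / 2) * min P Q
      + Real.exp (-(l * t)) * (P ^ (1 / 2 + t) * Q ^ (1 - (1 / 2 + t))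
        + P ^ (1 / 2 - t) * Q ^ (1 - (1 / 2 - t))) := by
  have hn : 0 ≤ Real.exp (l / 2) * min P Q
      + Real.exp (-(l * t)) * (P ^ (1 / 2 + t) * Q ^ (1 - (1 / 2 + t))
        + P ^ (1 / 2 - t) * Q ^ (1 - (1 / 2 - t))) := by positivity
  rcases hP.eq_or_lt with rfl | hP
  · rwa [Real.zero_rpow (by norm_num), zero_mul]
  rcases hQ.eq_or_lt with rfl | hQ
  · rwa [Real.zero_rpow (x := 1 - 1 / 2) (by norm_num), mul_zero]
  have e : ∀ x y : ℝ, P ^ x * Q ^ y = Real.exp (Real.log P * x + Real.log Q * y) := fun x y => by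
    rw [Real.rpow_def_of_pos hP, Real.rpow_def_of_pos hQ, Real.exp_add]
  rw [e, e, e]
  have hP' : P = Real.exp (Real.log P) := (Real.exp_log hP).symm
  have hQ' : Q = Real.exp (Real.log Q) := (Real.exp_log hQ).symm
  set α := Real.log P
  set β := Real.log Q
  rw [hP', hQ', mul_add, ← Real.exp_add, ← Real.exp_add]
  have m0 : 0 ≤ Real.exp (l / 2) * min (Real.exp α) (Real.exp β) := by positivity
  rcases le_or_gt (α - β) l with h1 | h1
  · rcases le_or_gt (β - α) l with h2 | h2
    · have : Real.exp (α * (1 / 2) + β * (1 - 1 / 2)) ≤ Real.exp (l / 2) * min (Real.exp α) (Real.exp β) := by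
        rw [mul_min_of_nonneg _ _ (Real.exp_pos _).le, ← Real.exp_add, ← Real.exp_add, le_min_iff,
          Real.exp_le_exp, Real.exp_le_exp]
        constructor <;> linarith
      have := Real.exp_pos (-(l * t) + (α * (1 / 2 + t) + β * (1 - (1 / 2 + t))))
      have := Real.exp_pos (-(l * t) + (α * (1 / 2 - t) + β * (1 - (1 / 2 - t))))
      linarith
    · have : Real.exp (α * (1 / 2) + β * (1 - 1 / 2))
          ≤ Real.exp (-(l * t) + (α * (1 / 2 - t) + β * (1 - (1 / 2 - t)))) :=
        Real.exp_le_exp.2 (by nlinarith)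
      have := Real.exp_pos (-(l * t) + (α * (1 / 2 + t) + β * (1 - (1 / 2 + t))))
      linarith
  · have : Real.exp (α * (1 / 2) + β * (1 - 1 / 2))
        ≤ Real.exp (-(l * t) + (α * (1 / 2 + t) + β * (1 - (1 / 2 + t)))) :=
      Real.exp_le_exp.2 (by nlinarith)
    have := Real.exp_pos (-(l * t) + (α * (1 / 2 - t) + β * (1 - (1 / 2 - t))))
    linarith

/-- A lower bound for the sum of the error probabilities of a test between two densities. -/
theorem affinity_pow_le {p q : ℝ → ℝ} (hp : Measurable p) (hq : Measurable q)
    (hp0 : ∀ x, 0 ≤ p x) (hq0 : ∀ x, 0 ≤ q x)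
    (hp1 : ∫⁻ x, ENNReal.ofReal (p x) ≠ ∞) (hq1 : ∫⁻ x, ENNReal.ofReal (q x) ≠ ∞)
    {n : ℕ} {E₁ E₂ : Set (Fin n → ℝ)} (hE₁ : MeasurableSet E₁) (hE₂ : MeasurableSet E₂)
    (hE : E₁ ∪ E₂ = univ) (l : ℝ) {t : ℝ} (ht : 0 < t) :
    (∫⁻ x, ENNReal.ofReal (p x ^ (1 / 2 : ℝ) * q x ^ (1 - 1 / 2 : ℝ))) ^ n
      ≤ ENNReal.ofReal (Real.exp (l / 2)) * (iidLaw p n E₁ + iidLaw q n E₂)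
        + ENNReal.ofReal (Real.exp (-(l * t))) *
          ((∫⁻ x, ENNReal.ofReal (p x ^ (1 / 2 + t) * q x ^ (1 - (1 / 2 + t)))) ^ n
            + (∫⁻ x, ENNReal.ofReal (p x ^ (1 / 2 - t) * q x ^ (1 - (1 / 2 - t)))) ^ n) := by
  have hm : ∀ s : ℝ, Measurable fun x => ENNReal.ofReal (p x ^ s * q x ^ (1 - s)) := fun s =>
    ((hp.pow_const s).mul (hq.pow_const _)).ennreal_ofReal
  have hpow : ∀ s : ℝ, (∫⁻ x, ENNReal.ofReal (p x ^ s * q x ^ (1 - s))) ^ n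
      = ∫⁻ x : Fin n → ℝ, ENNReal.ofReal ((∏ i, p (x i)) ^ s * (∏ i, q (x i)) ^ (1 - s)) := by
    intro s
    have := lintegral_pi_prod_eq_prod n (μ := fun _ => (volume : Measure ℝ)) fun _ => hm s
    rw [Finset.prod_const, Finset.card_univ, Fintype.card_fin, ← volume_pi] at this
    rw [← this]
    congr 1; ext x
    rw [← ENNReal.ofReal_prod_of_nonneg fun i _ =>
      mul_nonneg (Real.rpow_nonneg (hp0 _) _) (Real.rpow_nonneg (hq0 _) _), Finset.prod_mul_distrib,
      Real.finsetProd_rpow _ _ fun i _ => hp0 _, Real.finsetProd_rpow _ _ fun i _ => hq0 _]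
  have hmp : Measurable fun x : Fin n → ℝ => ∏ i, p (x i) :=
    Finset.measurable_fun_prod _ fun i _ => hp.comp (measurable_pi_apply i)
  have hmq : Measurable fun x : Fin n → ℝ => ∏ i, q (x i) :=
    Finset.measurable_fun_prod _ fun i _ => hq.comp (measurable_pi_apply i)
  have hPQ : ∀ s : ℝ, Measurable fun x : Fin n → ℝ =>
      ENNReal.ofReal ((∏ i, p (x i)) ^ s * (∏ i, q (x i)) ^ (1 - s)) := fun s =>
    ((hmp.pow_const s).mul (hmq.pow_const _)).ennreal_ofReal
  have hlaw : ∀ {r : ℝ → ℝ}, Measurable r → (∀ x, 0 ≤ r x) → ∫⁻ x, ENNReal.ofReal (r x) ≠ ∞ →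
      ∀ {E : Set (Fin n → ℝ)}, MeasurableSet E → iidLaw r n E
        = ∫⁻ x, E.indicator (fun x => ENNReal.ofReal (∏ i, r (x i))) x := by
    intro r hr hr0 hr1 E hE
    rw [iidLaw_eq_withDensity hr hr1, withDensity_apply _ hE, lintegral_indicator hE]
    congr 1; ext x
    rw [ENNReal.ofReal_prod_of_nonneg fun i _ => hr0 _]
  have hsum : Measurable fun x : Fin n → ℝ => E₁.indicator (fun x => ENNReal.ofReal (∏ i, p (x i))) x
      + E₂.indicator (fun x => ENNReal.ofReal (∏ i, q (x i))) x :=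
    (hmp.ennreal_ofReal.indicator hE₁).add (hmq.ennreal_ofReal.indicator hE₂)
  rw [hpow, hpow, hpow, hlaw hp hp0 hp1 hE₁, hlaw hq hq0 hq1 hE₂,
    ← lintegral_add_left (hmp.ennreal_ofReal.indicator hE₁), ← lintegral_add_left (hPQ _),
    ← lintegral_const_mul _ hsum, ← lintegral_const_mul _ ((hPQ _).fun_add (hPQ _)),
    ← lintegral_add_left (hsum.const_mul _)]
  refine lintegral_mono fun x => ?_
  have hP : 0 ≤ ∏ i, p (x i) := Finset.prod_nonneg fun i _ => hp0 _
  have hQ : 0 ≤ ∏ i, q (x i) := Finset.prod_nonneg fun i _ => hq0 _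
  -- Since the two error events cover the sample space, at least one likelihood is counted at every
  -- point.
  have hmin : ENNReal.ofReal (min (∏ i, p (x i)) (∏ i, q (x i)))
      ≤ E₁.indicator (fun x => ENNReal.ofReal (∏ i, p (x i))) x
        + E₂.indicator (fun x => ENNReal.ofReal (∏ i, q (x i))) x := by
    have hx : x ∈ E₁ ∪ E₂ := hE ▸ mem_univ x
    rcases hx with hx | hx
    · rw [indicator_of_mem hx]
      exact le_add_right (ENNReal.ofReal_le_ofReal (min_le_left _ _))
    · rw [indicator_of_mem hx (fun x => ENNReal.ofReal (∏ i, q (x i)))]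
      exact le_add_left (ENNReal.ofReal_le_ofReal (min_le_right _ _))
  generalize (∏ i, p (x i)) = P at *
  generalize (∏ i, q (x i)) = Q at *
  refine (ENNReal.ofReal_le_ofReal (sqrt_mul_le (l := l) hP hQ ht)).trans ?_
  rw [ENNReal.ofReal_add (by positivity) (by positivity), ENNReal.ofReal_mul (by positivity),
    ENNReal.ofReal_mul (by positivity), ENNReal.ofReal_add (by positivity) (by positivity)]
  gcongr

/-- A first exponential rate above `R` makes the error probability smaller than `exp (-n R)`. -/
theorem eventually_le_exp_of_lt_firstRate {p : ℝ → ℝ → ℝ} {T : Estimator} {θ ε R : ℝ}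
    (h : (R : EReal) < firstRate p T θ ε) :
    ∀ᶠ n : ℕ in atTop, iidLaw (p θ) n {x | ε ≤ |T.est n x - θ|} ≤ ENNReal.ofReal (Real.exp (-(n * R))) := by
  filter_upwards [eventually_lt_of_lt_liminf h, eventually_gt_atTop 0] with n hn hn0
  have hn0' : (0 : EReal) < (n : EReal) := by exact_mod_cast hn0
  rw [EReal.lt_div_iff hn0' (EReal.natCast_ne_top n)] at hn
  rw [← ENNReal.log_le_log_iff, ENNReal.log_ofReal_of_pos (Real.exp_pos _), Real.log_exp]
  have h2 := EReal.lt_neg_comm.1 hn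
  refine h2.le.trans (le_of_eq ?_)
  push_cast
  rw [mul_comm]

/-- Two-point bound for the first exponential rates. -/
theorem min_firstRate_le {p : ℝ → ℝ → ℝ} (T : Estimator) {θ ε : ℝ} (hm : ∀ θ, Measurable (p θ))
    (h0 : ∀ θ x, 0 ≤ p θ x) (h1 : ∀ θ, ∫⁻ x, ENNReal.ofReal (p θ x) ≠ ∞) {Z : ℝ → ℝ}
    (hZ : ∀ s ∈ Ioo (0 : ℝ) 1, 0 < Z s ∧
      ∫⁻ x, ENNReal.ofReal (p (θ - ε) x ^ s * p (θ + ε) x ^ (1 - s)) = ENNReal.ofReal (Z s))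
    {δ t R : ℝ} (ht : 0 < t) (ht' : t < 1 / 2) (hR : -Real.log (Z (1 / 2)) + δ / 2 < R)
    (hp : Real.exp (-(δ * t)) * Z (1 / 2 + t) < Z (1 / 2))
    (hq : Real.exp (-(δ * t)) * Z (1 / 2 - t) < Z (1 / 2)) :
    firstRate p T (θ - ε) ε ≤ R ∨ firstRate p T (θ + ε) ε ≤ R := by
  by_contra! hcon
  obtain ⟨z0, hz⟩ := hZ (1 / 2) ⟨by norm_num, by norm_num⟩
  obtain ⟨p0, hzp⟩ := hZ (1 / 2 + t) ⟨by linarith, by linarith⟩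
  obtain ⟨q0, hzq⟩ := hZ (1 / 2 - t) ⟨by linarith, by linarith⟩
  generalize Z (1 / 2) = z at *
  generalize Z (1 / 2 + t) = zp at *
  generalize Z (1 / 2 - t) = zq at *
  -- If both rates exceeded R, dividing the testing inequality with l = nδ by z^n would bound 1 by a
  -- sum of three powers. All three bases are below 1, a contradiction as n → ∞.
  have key : ∀ᶠ n : ℕ in atTop, 1 ≤ 2 * (Real.exp (δ / 2 - R) / z) ^ n
      + ((Real.exp (-(δ * t)) * zp / z) ^ n + (Real.exp (-(δ * t)) * zq / z) ^ n) := by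
    filter_upwards [eventually_le_exp_of_lt_firstRate hcon.1,
      eventually_le_exp_of_lt_firstRate hcon.2] with n e1 e2
    have hset : {x : Fin n → ℝ | ε ≤ |T.est n x - (θ - ε)|} ∪ {x | ε ≤ |T.est n x - (θ + ε)|} = univ := by
      refine eq_univ_of_forall fun x => ?_
      rcases le_total θ (T.est n x) with h | h
      · exact Or.inl ((by linarith : ε ≤ T.est n x - (θ - ε)).trans (le_abs_self _))
      · exact Or.inr ((by linarith : ε ≤ -(T.est n x - (θ + ε))).trans (neg_le_abs _))
    have hmeas : ∀ c : ℝ, MeasurableSet {x : Fin n → ℝ | ε ≤ |T.est n x - c|} := fun c =>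
      measurableSet_le measurable_const ((T.measurable_est n).sub_const c).abs
    have := affinity_pow_le (hm (θ - ε)) (hm (θ + ε)) (h0 _) (h0 _) (h1 _) (h1 _) (hmeas _) (hmeas _)
      hset (n * δ) ht
    rw [hz, hzp, hzq] at this
    have h2 : ENNReal.ofReal z ^ n ≤ ENNReal.ofReal (Real.exp (n * δ / 2)) *
        (ENNReal.ofReal (Real.exp (-(n * R))) + ENNReal.ofReal (Real.exp (-(n * R))))
        + ENNReal.ofReal (Real.exp (-(n * δ * t))) * (ENNReal.ofReal zp ^ n + ENNReal.ofReal zq ^ n) := by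
      refine this.trans ?_
      gcongr
    rw [← ENNReal.ofReal_pow z0.le, ← ENNReal.ofReal_pow p0.le, ← ENNReal.ofReal_pow q0.le,
      ← ENNReal.ofReal_add (by positivity) (by positivity), ← ENNReal.ofReal_add (by positivity) (by positivity),
      ← ENNReal.ofReal_mul (by positivity), ← ENNReal.ofReal_mul (by positivity),
      ← ENNReal.ofReal_add (by positivity) (by positivity), ENNReal.ofReal_le_ofReal_iff (by positivity)] at h2
    have x1 : Real.exp (n * δ / 2) * (Real.exp (-(n * R)) + Real.exp (-(n * R)))
        = 2 * Real.exp (δ / 2 - R) ^ n := by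
      rw [← Real.exp_nat_mul, mul_add, ← Real.exp_add, two_mul]
      ring_nf
    have x2 : Real.exp (-(n * δ * t)) = Real.exp (-(δ * t)) ^ n := by
      rw [← Real.exp_nat_mul]; ring_nf
    rw [x1, x2] at h2
    rw [div_pow, div_pow, div_pow, mul_div_assoc', ← add_div, ← add_div, le_div_iff₀ (by positivity),
      one_mul, mul_pow, mul_pow]
    linarith
  have hr1 : Real.exp (δ / 2 - R) / z < 1 := by
    rw [div_lt_one z0, ← Real.lt_log_iff_exp_lt z0]; linarith
  have lim := (((tendsto_pow_atTop_nhds_zero_of_lt_one (by positivity) hr1).const_mul 2).add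
    ((tendsto_pow_atTop_nhds_zero_of_lt_one (by positivity) ((div_lt_one z0).2 hp)).add
      (tendsto_pow_atTop_nhds_zero_of_lt_one (by positivity) ((div_lt_one z0).2 hq))))
  have := ge_of_tendsto lim key
  norm_num at this

/-! ### The upper bound for interval estimation -/

namespace IsIntervalDensity

variable {f : ℝ → ℝ} {a b A₁ A₂ : ℝ}

theorem measurable_shift (hf : IsIntervalDensity f a b 2 2 A₁ A₂)
    (hconc : ConcaveOn ℝ (Ioo a b) fun x => Real.log (f x)) (θ : ℝ) : Measurable (shiftFamily f θ) :=
  (hf.continuous hconc).measurable.comp (measurable_id.sub_const θ)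

theorem lintegral_shift (hf : IsIntervalDensity f a b 2 2 A₁ A₂) (θ : ℝ) :
    ∫⁻ x, ENNReal.ofReal (shiftFamily f θ x) = 1 :=
  (lintegral_sub_right_eq_self (fun x => ENNReal.ofReal (f x)) θ).trans hf.integral_eq_one

theorem eventually_localRate_le (hf : IsIntervalDensity f a b 2 2 A₁ A₂)
    (hconc : ConcaveOn ℝ (Ioo a b) fun x => Real.log (f x)) (θ : ℝ) {γ : ℝ} (hγ : 0 < γ) :
    ∀ᶠ ε in 𝓝[>] (0 : ℝ), ∀ T : Estimator,
      localRate (shiftFamily f) T θ ε ≤ ((((A₁ + A₂) / 2 + γ) * gLog ε : ℝ) : EReal) := by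
  set c := (A₁ + A₂) / 2 with hc
  have hc0 : 0 < c := by have := hf.coeff_pos; linarith [this.1, this.2]
  set γ' := γ / 8 with hγ'
  have hγ0 : 0 < γ' := by positivity
  -- Changing the order from 1/2 to 1/2 ± t alters the entropy by c t² G plus errors 2(tγ'/8) G,
  -- where G = g(2ε). Since c t ≤ γ'/2, this stays below the gain δt with δ = γ' G.
  set t := γ' / (2 * c + 4 * γ') with htdef
  have ht : 0 < t := by positivity
  have ht4 : t < 1 / 2 := by rw [htdef, div_lt_div_iff₀ (by positivity) (by norm_num)]; linarith
  have htc : c * t ≤ γ' / 2 := by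
    rw [htdef, mul_div_assoc', div_le_div_iff₀ (by positivity) (by norm_num)]; nlinarith
  have hκ : 0 < t * γ' / 8 := by positivity
  have hdbl : Tendsto (fun ε : ℝ => 2 * ε) (𝓝[>] 0) (𝓝[>] 0) := by
    refine tendsto_nhdsWithin_iff.2 ⟨?_, ?_⟩
    · have : Tendsto (fun ε : ℝ => 2 * ε) (𝓝 0) (𝓝 (2 * 0)) := Continuous.tendsto (by fun_prop) 0
      rw [mul_zero] at this
      exact this.mono_left nhdsWithin_le_nhds
    · filter_upwards [self_mem_nhdsWithin] with ε hε
      exact mul_pos two_pos (mem_Ioi.1 hε)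
  -- The tested points are 2ε apart: g(2ε) ~ 4 g(ε) compensates the factor 1/4 = s(1-s) at s = 1/2.
  -- The slack is fitted to `hR`.
  have hscale : ∀ᶠ ε in 𝓝[>] (0 : ℝ), gLog (2 * ε) / gLog ε < 4 + 2 * γ / (c + γ) := by
    refine (isScalingExponent_gLog.2 2 two_pos).eventually_lt_const ?_
    rw [Real.rpow_two]
    have : 0 < 2 * γ / (c + γ) := by positivity
    linarith
  filter_upwards [hdbl.eventually (hf.eventually_neg_log_affinity hconc hκ),
    hdbl.eventually eventually_gLog_pos, eventually_gLog_pos, hscale, self_mem_nhdsWithin]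
    with ε hZ hG hg hsc hε T
  have hε : 0 < ε := hε
  rw [div_lt_iff₀ hg] at hsc
  rw [← hc] at hZ
  have hR : (c / 4 + γ') * gLog (2 * ε) ≤ (c + γ) * gLog ε := by
    have h1 : (c / 4 + γ') * (4 + 2 * γ / (c + γ)) ≤ c + γ := by
      have : (c / 4 + γ') * (2 * γ / (c + γ)) ≤ γ / 2 := by
        rw [mul_div_assoc', div_le_iff₀ (by positivity), hγ']; nlinarith [mul_pos hc0 hγ]
      rw [mul_add]; linarith
    calc _ ≤ (c / 4 + γ') * ((4 + 2 * γ / (c + γ)) * gLog ε) := by gcongr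
      _ = (c / 4 + γ') * (4 + 2 * γ / (c + γ)) * gLog ε := by ring
      _ ≤ _ := by gcongr
  set G := gLog (2 * ε) with hGdef
  have htγ : 0 < t * γ' * G := by positivity
  have z1 := hZ (1 / 2) ⟨by norm_num, by norm_num⟩
  have tail : ∀ s ∈ Ioo (0 : ℝ) 1, s * (1 - s) = 1 / 4 - t ^ 2 →
      Real.exp (-((γ' * G) * t)) * affinity f s (2 * ε) < affinity f (1 / 2) (2 * ε) := by
    intro s hs hst
    have z2 := hZ s hs
    rw [hst] at z2
    conv_lhs => rw [← Real.exp_log z2.1, ← Real.exp_add]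
    conv_rhs => rw [← Real.exp_log z1.1]
    rw [Real.exp_lt_exp]
    have := (abs_le.1 z1.2).2
    have := (abs_le.1 z2.2).1
    have : c * t * (t * G) ≤ γ' / 2 * (t * G) := by gcongr
    linarith
  have := min_firstRate_le (p := shiftFamily f) T (θ := θ) (ε := ε) (hf.measurable_shift hconc)
    (fun θ x => hf.nonneg _) (fun θ => by rw [hf.lintegral_shift]; exact ENNReal.one_ne_top)
    (Z := fun s => affinity f s (2 * ε))
    (fun s hs => ⟨(hZ s hs).1, by
      rw [hf.lintegral_shift_eq hconc hs, show θ + ε - (θ - ε) = 2 * ε by ring]⟩)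
    (δ := γ' * G) (R := (c + γ) * gLog ε) ht ht4 (by
      have := (abs_le.1 z1.2).2
      have : t * γ' * G ≤ 1 * γ' * G := by gcongr; linarith
      have := mul_pos hγ0 hG
      linarith)
    (tail _ ⟨by linarith, by linarith⟩ (by ring)) (tail _ ⟨by linarith, by linarith⟩ (by ring))
  rcases this with h | h
  · exact (iInf₂_le (θ - ε) ⟨le_rfl, by linarith⟩).trans h
  · exact (iInf₂_le (θ + ε) ⟨by linarith, le_rfl⟩).trans h

theorem alpha1_le (hf : IsIntervalDensity f a b 2 2 A₁ A₂)
    (hconc : ConcaveOn ℝ (Ioo a b) fun x => Real.log (f x)) (θ : ℝ) :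
    alpha1 (shiftFamily f) gLog θ ≤ (((A₁ + A₂) / 2 : ℝ) : EReal) := by
  refine EReal.le_of_forall_lt_iff_le.1 fun z hz => ?_
  rw [EReal.coe_lt_coe_iff] at hz
  refine limsup_le_of_le (by isBoundedDefault) ?_
  filter_upwards [hf.eventually_localRate_le hconc θ (sub_pos.2 hz), eventually_gLog_pos] with ε h hg
  rw [EReal.div_le_iff_le_mul (by exact_mod_cast hg) (EReal.coe_ne_top _)]
  refine iSup_le fun T => (h T).trans (le_of_eq ?_)
  rw [← EReal.coe_mul]
  congr 1; ring

end IsIntervalDensity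

theorem alpha2Of_le_alpha1 (p : ℝ → ℝ → ℝ) (T : Estimator) (θ : ℝ) :
    alpha2Of p gLog T θ ≤ alpha1 p gLog θ := by
  refine (liminf_le_limsup).trans (limsup_le_limsup ?_)
  filter_upwards [eventually_gLog_pos] with ε hg
  exact EReal.div_le_div_right_of_nonneg (by exact_mod_cast hg.le) (le_iSup (fun T => localRate p T θ ε) T)

/-- The factor 2 comes from the two one-sided errors and costs only (log 2)/n in the exponent. -/
theorem le_firstRate_of_forall_le {p : ℝ → ℝ → ℝ} {T : Estimator} {θ ε R : ℝ}
    (h : ∀ n : ℕ, iidLaw (p θ) n {x | ε ≤ |T.est n x - θ|} ≤ 2 * ENNReal.ofReal (Real.exp (-R)) ^ n) :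
    (R : EReal) ≤ firstRate p T θ ε := by
  refine EReal.ge_of_forall_gt_iff_ge.1 fun z hz => ?_
  rw [EReal.coe_lt_coe_iff] at hz
  refine le_liminf_of_le (by isBoundedDefault) ?_
  obtain ⟨N, hN⟩ := exists_nat_gt (Real.log 2 / (R - z))
  filter_upwards [eventually_ge_atTop N, eventually_gt_atTop 0] with n hn hn0
  have hn0' : (0 : EReal) < (n : EReal) := by exact_mod_cast hn0
  have hle : iidLaw (p θ) n {x | ε ≤ |T.est n x - θ|} ≤ ENNReal.ofReal (Real.exp (-(z * n))) := by
    refine (h n).trans ?_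
    rw [← ENNReal.ofReal_pow (Real.exp_pos _).le, ← ENNReal.ofReal_ofNat,
      ← ENNReal.ofReal_mul (by norm_num)]
    refine ENNReal.ofReal_le_ofReal ?_
    rw [← Real.exp_nat_mul, ← Real.exp_log (zero_lt_two' ℝ), ← Real.exp_add, Real.exp_le_exp]
    have hNn : (N : ℝ) ≤ n := by exact_mod_cast hn
    rw [div_lt_iff₀ (sub_pos.2 hz)] at hN
    have : (N : ℝ) * (R - z) ≤ n * (R - z) := by
      have := sub_pos.2 hz; gcongr
    linarith
  rw [EReal.le_div_iff_mul_le hn0' (EReal.natCast_ne_top n), EReal.le_neg]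
  rw [← ENNReal.log_le_log_iff, ENNReal.log_ofReal_of_pos (Real.exp_pos _), Real.log_exp] at hle
  refine hle.trans (le_of_eq ?_)
  push_cast
  rfl

/-! ### Achievability by maximum likelihood -/

namespace IsIntervalDensity

variable {f : ℝ → ℝ} {a b A₁ A₂ : ℝ}

theorem sum_log_le_of_isMLE {κ₁ κ₂ : ℝ} (hf : IsIntervalDensity f a b κ₁ κ₂ A₁ A₂) {T : Estimator}
    (hT : IsMLE (shiftFamily f) T) {n : ℕ} {x : Fin n → ℝ} {u : ℝ}
    (hx : ∀ i, x i - T.est n x ∈ Ioo a b) (hu : ∀ i, x i - u ∈ Ioo a b) :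
    ∑ i, Real.log (f (x i - u)) ≤ ∑ i, Real.log (f (x i - T.est n x)) := by
  rw [← Real.log_prod fun i _ => (hf.pos _ (hu i)).ne', ← Real.log_prod fun i _ => (hf.pos _ (hx i)).ne']
  exact Real.log_le_log (Finset.prod_pos fun i _ => hf.pos _ (hu i)) (hT n x u)

/-- The score changes sign at a maximum likelihood estimate. -/
theorem mul_sum_score_nonpos {κ₁ κ₂ : ℝ} (hf : IsIntervalDensity f a b κ₁ κ₂ A₁ A₂)
    (hconc : ConcaveOn ℝ (Ioo a b) fun x => Real.log (f x)) {T : Estimator}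
    (hT : IsMLE (shiftFamily f) T) {n : ℕ} {x : Fin n → ℝ} {u h : ℝ}
    (hx : ∀ i, x i - T.est n x ∈ Ioo a b) (hu : ∀ i, x i - u ∈ Ioo a b)
    (hh : 0 ≤ h * (T.est n x - u)) (h0 : h ≠ 0) :
    h * ∑ i, deriv f (x i - u) / f (x i - u) ≤ 0 := by
  rcases eq_or_ne (T.est n x) u with he | hne
  -- The boundary case must be included because the error event is closed. The tangent inequality
  -- then says nothing, but the score vanishes at an interior maximum.
  · have hd : HasDerivAt (fun τ => ∑ i, Real.log (f (x i - τ)))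
        (∑ i, (deriv f (x i - u) / f (x i - u)) * (-1)) u := by
      refine HasDerivAt.fun_sum fun i _ => ?_
      exact (hf.hasDerivAt_log (hu i)).comp u ((hasDerivAt_id u).const_sub (x i))
    have hmax : IsLocalMax (fun τ => ∑ i, Real.log (f (x i - τ))) u := by
      have : ∀ᶠ τ in 𝓝 u, ∀ i, x i - τ ∈ Ioo a b := by
        refine eventually_all.2 fun i => ?_
        exact (continuous_const.sub continuous_id).continuousAt.eventually
          (isOpen_Ioo.mem_nhds (hu i))
      filter_upwards [this] with τ hτ
      have := hf.sum_log_le_of_isMLE hT hx hτ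
      rwa [he] at this
    have := hmax.hasDerivAt_eq_zero hd
    rw [← Finset.sum_mul] at this
    have : ∑ i, deriv f (x i - u) / f (x i - u) = 0 := by linarith
    rw [this, mul_zero]
  · have h1 := hf.sum_log_le_of_isMLE hT hx hu
    have h2 : ∑ i, Real.log (f (x i - T.est n x)) ≤ ∑ i, (Real.log (f (x i - u))
        + (u - T.est n x) * (deriv f (x i - u) / f (x i - u))) := by
      refine Finset.sum_le_sum fun i _ => ?_
      have := hf.log_le_tangent hconc (hu i) (hx i)
      rwa [show x i - T.est n x - (x i - u) = u - T.est n x by ring] at this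
    rw [Finset.sum_add_distrib, ← Finset.mul_sum] at h2
    generalize (∑ i, deriv f (x i - u) / f (x i - u)) = S at *
    have h3 : (T.est n x - u) * S ≤ 0 := by linarith
    rcases hne.lt_or_gt with h4 | h4
    · have h5 : h < 0 := lt_of_le_of_ne (by nlinarith) h0
      have : 0 ≤ S := by nlinarith
      nlinarith
    · have h5 : 0 < h := lt_of_le_of_ne (by nlinarith) h0.symm
      have : S ≤ 0 := by nlinarith
      nlinarith

/-- The point θ + h lies between θ and τ, so x - (θ + h) lies between two points of the interval. -/
theorem shift_mem_Ioo {x θ h τ : ℝ} (h0 : h ≠ 0) (hh : 0 ≤ h * (τ - (θ + h))) (h1 : x - θ ∈ Ioo a b)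
    (h2 : x - τ ∈ Ioo a b) : x - (θ + h) ∈ Ioo a b := by
  rcases h0.lt_or_gt with h3 | h3
  · have : τ - (θ + h) ≤ 0 := by nlinarith
    exact ⟨by linarith [h1.1], by linarith [h2.2]⟩
  · have : 0 ≤ τ - (θ + h) := by nlinarith
    exact ⟨by linarith [h2.1], by linarith [h1.2]⟩

/-- Chernoff's bound for the one-sided error of a maximum likelihood estimator. -/
theorem iidLaw_isMLE_le (hf : IsIntervalDensity f a b 2 2 A₁ A₂)
    (hconc : ConcaveOn ℝ (Ioo a b) fun x => Real.log (f x)) {T : Estimator}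
    (hT : IsMLE (shiftFamily f) T) (n : ℕ) (θ : ℝ) {h : ℝ} (h0 : h ≠ 0) :
    iidLaw (shiftFamily f θ) n {x | 0 ≤ h * (T.est n x - (θ + h))}
      ≤ ENNReal.ofReal (∫ y in Ioo a b, f (y + h) * Real.exp (-(h * (deriv f y / f y)))) ^ n := by
  set G : ℝ → ℝ≥0∞ := (Ioo a b).indicator
    fun y => ENNReal.ofReal (f (y + h) * Real.exp (-(h * (deriv f y / f y)))) with hG
  have hfm := (hf.continuous hconc).measurable
  have hGm : Measurable G := by
    refine Measurable.indicator ?_ measurableSet_Ioo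
    have h1 : Measurable fun y => f (y + h) := hfm.comp (by fun_prop)
    exact (h1.mul ((((measurable_deriv f).div hfm).const_mul h).neg.exp)).ennreal_ofReal
  have hint : ∫⁻ x, G (x - (θ + h))
      = ENNReal.ofReal (∫ y in Ioo a b, f (y + h) * Real.exp (-(h * (deriv f y / f y)))) := by
    rw [lintegral_sub_right_eq_self G, hG, lintegral_indicator measurableSet_Ioo,
      ofReal_integral_eq_lintegral_ofReal (hf.tangent_integrableOn hconc h)
        (ae_of_all _ fun y => mul_nonneg (hf.nonneg _) (Real.exp_pos _).le)]
  rw [← hint]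
  refine iidLaw_le_pow (hf.measurable_shift hconc θ)
    (by rw [hf.lintegral_shift]; exact ENNReal.one_ne_top)
    (measurableSet_le measurable_const (((T.measurable_est n).sub_const _).const_mul h))
    (hGm.comp (measurable_id.sub_const _)) fun x hx => ?_
  have hx : 0 ≤ h * (T.est n x - (θ + h)) := hx
  rw [← ENNReal.ofReal_prod_of_nonneg (f := fun i => shiftFamily f θ (x i)) fun i _ => hf.nonneg _]
  rcases (Finset.prod_nonneg fun i _ => hf.nonneg _ : 0 ≤ ∏ i, shiftFamily f θ (x i)).eq_or_lt
    with hz | hz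
  · rw [← hz, ENNReal.ofReal_zero]; exact zero_le
  have mem_of_prod_pos : ∀ τ, 0 < ∏ i, shiftFamily f τ (x i) → ∀ i, x i - τ ∈ Ioo a b := by
    intro τ hτ i
    by_contra hi
    exact hτ.ne' (Finset.prod_eq_zero (Finset.mem_univ i) (hf.zero _ hi))
  have m1 := mem_of_prod_pos θ hz
  have m2 := mem_of_prod_pos (T.est n x) (hz.trans_le (hT n x θ))
  -- Positive likelihood at θ forces positive likelihood at the maximizer, hence at the intermediate
  -- parameter θ + h, where the score is therefore defined.
  have m3 : ∀ i, x i - (θ + h) ∈ Ioo a b := fun i => shift_mem_Ioo h0 hx (m1 i) (m2 i)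
  have hscore := hf.mul_sum_score_nonpos hconc hT m2 m3 hx h0
  have e : ∏ i, G (x i - (θ + h)) = ENNReal.ofReal ((∏ i, shiftFamily f θ (x i))
      * Real.exp (-(h * ∑ i, deriv f (x i - (θ + h)) / f (x i - (θ + h))))) := by
    rw [Finset.mul_sum, ← Finset.sum_neg_distrib, Real.exp_sum, ← Finset.prod_mul_distrib,
      ENNReal.ofReal_prod_of_nonneg (f := fun i => shiftFamily f θ (x i) * Real.exp _) fun i _ =>
        mul_nonneg (hf.nonneg _) (Real.exp_pos _).le]
    refine Finset.prod_congr rfl fun i _ => ?_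
    rw [hG, indicator_of_mem (m3 i), shiftFamily, show x i - (θ + h) + h = x i - θ by ring]
  rw [e]
  -- Chernoff's step: on this event the exponential of -h times the score sum is at least 1.
  refine ENNReal.ofReal_le_ofReal (le_mul_of_one_le_right hz.le (Real.one_le_exp (by linarith)))

theorem eventually_le_localRate (hf : IsIntervalDensity f a b 2 2 A₁ A₂)
    (hconc : ConcaveOn ℝ (Ioo a b) fun x => Real.log (f x)) {T : Estimator}
    (hT : IsMLE (shiftFamily f) T) (θ : ℝ) {κ : ℝ} (hκ : 0 < κ) :
    ∀ᶠ ε in 𝓝[>] (0 : ℝ),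
      ((((A₁ + A₂) / 2 - κ) * gLog ε : ℝ) : EReal) ≤ localRate (shiftFamily f) T θ ε := by
  filter_upwards [hf.eventually_integral_tangent_le hconc hκ, self_mem_nhdsWithin] with ε hJ hε
  have hε : 0 < ε := hε
  refine le_iInf₂ fun θ' _ => le_firstRate_of_forall_le fun n => ?_
  have hside : ∀ h, |h| = ε → iidLaw (shiftFamily f θ') n {x | 0 ≤ h * (T.est n x - (θ' + h))}
      ≤ ENNReal.ofReal (Real.exp (-(((A₁ + A₂) / 2 - κ) * gLog ε))) ^ n := by
    intro h hh
    refine (hf.iidLaw_isMLE_le hconc hT n θ' (abs_pos.1 (hh ▸ hε))).trans ?_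
    gcongr
    refine (hJ h hh).trans ?_
    -- By 1 - x ≤ exp(-x). The bound does not involve θ', so the infimum over the neighbourhood
    -- costs nothing.
    linarith [Real.add_one_le_exp (-(((A₁ + A₂) / 2 - κ) * gLog ε))]
  rw [two_mul]
  refine le_trans (measure_mono ?_) ((measure_union_le _ _).trans (add_le_add
    (hside ε (abs_of_pos hε)) (hside (-ε) (by rw [abs_neg, abs_of_pos hε]))))
  intro x hx
  have hx : ε ≤ |T.est n x - θ'| := hx
  rcases le_abs.1 hx with h | h
  · exact Or.inl (mul_nonneg hε.le (by linarith))
  · exact Or.inr (mul_nonneg_of_nonpos_of_nonpos (neg_nonpos.2 hε.le) (by linarith))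

theorem le_alpha2Of (hf : IsIntervalDensity f a b 2 2 A₁ A₂)
    (hconc : ConcaveOn ℝ (Ioo a b) fun x => Real.log (f x)) {T : Estimator}
    (hT : IsMLE (shiftFamily f) T) (θ : ℝ) :
    (((A₁ + A₂) / 2 : ℝ) : EReal) ≤ alpha2Of (shiftFamily f) gLog T θ := by
  refine EReal.ge_of_forall_gt_iff_ge.1 fun z hz => ?_
  rw [EReal.coe_lt_coe_iff] at hz
  refine le_liminf_of_le (by isBoundedDefault) ?_
  filter_upwards [hf.eventually_le_localRate hconc hT θ (sub_pos.2 hz), eventually_gLog_pos] with ε h hg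
  rw [EReal.le_div_iff_mul_le (by exact_mod_cast hg) (EReal.coe_ne_top _)]
  refine le_trans (le_of_eq ?_) h
  rw [← EReal.coe_mul]
  congr 1; ring

/-! ### Existence of a measurable maximum likelihood estimator -/

/-- The smallest maximizer of the likelihood is a measurable function of the data. -/
theorem exists_measurable_maximizer (hf : IsIntervalDensity f a b 2 2 A₁ A₂)
    (hconc : ConcaveOn ℝ (Ioo a b) fun x => Real.log (f x)) (n : ℕ) :
    ∃ T : (Fin n → ℝ) → ℝ, Measurable T ∧
      ∀ x θ, ∏ i, shiftFamily f θ (x i) ≤ ∏ i, shiftFamily f (T x) (x i) := by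
  rcases n with _ | n
  · exact ⟨fun _ => 0, measurable_const, fun x θ => by simp⟩
  set Λ : (Fin (n + 1) → ℝ) → ℝ → ℝ := fun x θ => ∏ i, shiftFamily f θ (x i) with hΛ
  have hfc := hf.continuous hconc
  have hc : Continuous fun z : (Fin (n + 1) → ℝ) × ℝ => Λ z.1 z.2 := by
    simp only [hΛ, shiftFamily]
    exact continuous_finsetProd _ fun i _ => hfc.comp (by fun_prop)
  have hcx : ∀ x, Continuous (Λ x) := fun x => hc.comp (Continuous.prodMk_right x)
  -- The constraint from the first observation makes the set of maximizers compact even when the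
  -- likelihood vanishes identically.
  set S : (Fin (n + 1) → ℝ) → Set ℝ := fun x =>
    {θ | x 0 - θ ∈ Icc a b ∧ ∀ θ', Λ x θ' ≤ Λ x θ} with hS
  have hne : ∀ x, (S x).Nonempty := by
    intro x
    obtain ⟨θ, hθ, hmax⟩ := (isCompact_Icc (a := x 0 - b) (b := x 0 - a)).exists_isMaxOn
      (nonempty_Icc.2 (by linarith [hf.lt])) (hcx x).continuousOn
    refine ⟨θ, ⟨by linarith [hθ.2], by linarith [hθ.1]⟩, fun θ' => ?_⟩
    by_cases h : θ' ∈ Icc (x 0 - b) (x 0 - a)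
    · exact hmax h
    · have : Λ x θ' = 0 := Finset.prod_eq_zero (Finset.mem_univ 0)
        (hf.zero _ fun h' => h ⟨by linarith [h'.2], by linarith [h'.1]⟩)
      rw [this]
      exact Finset.prod_nonneg fun i _ => hf.nonneg _
  have hclosed : ∀ x, IsClosed (S x) := by
    intro x
    refine IsClosed.and (isClosed_Icc.preimage (by fun_prop)) ?_
    rw [ofPred_forall]
    exact isClosed_iInter fun θ' => isClosed_le continuous_const (hcx x)
  have hbdd : ∀ x, BddBelow (S x) := fun x => ⟨x 0 - b, fun θ hθ => by linarith [hθ.1.2]⟩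
  have hmem : ∀ x, sInf (S x) ∈ S x := fun x => (hclosed x).csInf_mem (hne x) (hbdd x)
  refine ⟨fun x => sInf (S x), measurable_of_Iic fun t => ?_, fun x θ => (hmem x).2 θ⟩
  -- With v = x₀ - θ the maximizer ranges over the fixed compact [a, b]. The event that the smallest
  -- maximizer is at most t is then the projection of a closed set along a compact factor, hence
  -- closed.
  have hcl : IsClosed {z : (Fin (n + 1) → ℝ) × Icc a b | z.1 0 - z.2 ≤ t ∧
      ∀ θ', Λ z.1 θ' ≤ Λ z.1 (z.1 0 - z.2)} := by
    refine IsClosed.and (isClosed_le (by fun_prop) continuous_const) ?_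
    rw [ofPred_forall]
    refine isClosed_iInter fun θ' => isClosed_le ?_ ?_
    · exact hc.comp (by fun_prop : Continuous fun z : (Fin (n + 1) → ℝ) × Icc a b => (z.1, θ'))
    · exact hc.comp (by fun_prop : Continuous fun z : (Fin (n + 1) → ℝ) × Icc a b =>
        (z.1, z.1 0 - (z.2 : ℝ)))
  have himg := (isClosedMap_fst_of_compactSpace _ hcl).measurableSet
  convert himg using 1
  ext x
  simp only [mem_preimage, mem_Iic, mem_image, Prod.exists, exists_and_right, exists_eq_right]
  constructor
  · intro h
    refine ⟨⟨x 0 - sInf (S x), (hmem x).1⟩, ?_⟩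
    refine ⟨by simpa using h, ?_⟩
    simpa using (hmem x).2
  · rintro ⟨v, hv1, hv2⟩
    exact (csInf_le (hbdd x) (show x 0 - (v : ℝ) ∈ S x from ⟨by simp, hv2⟩)).trans hv1

theorem exists_isMLE (hf : IsIntervalDensity f a b 2 2 A₁ A₂)
    (hconc : ConcaveOn ℝ (Ioo a b) fun x => Real.log (f x)) :
    ∃ T : Estimator, IsMLE (shiftFamily f) T := by
  choose T hm hT using hf.exists_measurable_maximizer hconc
  exact ⟨⟨T, hm⟩, hT⟩

end IsIntervalDensity

end LargeDeviation

end

/-! ### Closing the chain of inequalities -/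

theorem mainTheorem7 (f : ℝ → ℝ) (a b A₁ A₂ : ℝ)
    (hf : LargeDeviation.IsIntervalDensity f a b 2 2 A₁ A₂)
    (hconc : ConcaveOn ℝ (Set.Ioo a b) fun x => Real.log (f x)) (θ : ℝ) :
    LargeDeviation.IsScalingExponent LargeDeviation.gLog 2 ∧
    LargeDeviation.RenyiConvergesUniformly (LargeDeviation.shiftFamily f) LargeDeviation.gLog θ ∧
    LargeDeviation.alpha1 (LargeDeviation.shiftFamily f) LargeDeviation.gLog θ
      = (((A₁ + A₂) / 2 : ℝ) : EReal) ∧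
    LargeDeviation.alphaBar1 (LargeDeviation.shiftFamily f) LargeDeviation.gLog 2 θ
      = (((A₁ + A₂) / 2 : ℝ) : EReal) ∧
    LargeDeviation.alpha2 (LargeDeviation.shiftFamily f) LargeDeviation.gLog θ
      = (((A₁ + A₂) / 2 : ℝ) : EReal) ∧
    LargeDeviation.alphaBar2 (LargeDeviation.shiftFamily f) LargeDeviation.gLog 2 θ
      = (((A₁ + A₂) / 2 : ℝ) : EReal) ∧
    (∃ T : LargeDeviation.Estimator, LargeDeviation.IsMLE (LargeDeviation.shiftFamily f) T) ∧
    (∀ T : LargeDeviation.Estimator, LargeDeviation.IsMLE (LargeDeviation.shiftFamily f) T →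
      LargeDeviation.alpha2Of (LargeDeviation.shiftFamily f) LargeDeviation.gLog T θ
        = (((A₁ + A₂) / 2 : ℝ) : EReal)) := by
  have key : ∀ T : LargeDeviation.Estimator,
      LargeDeviation.IsMLE (LargeDeviation.shiftFamily f) T →
      (((A₁ + A₂) / 2 : ℝ) : EReal)
        ≤ LargeDeviation.alpha2Of (LargeDeviation.shiftFamily f) LargeDeviation.gLog T θ :=
    fun T hT => hf.le_alpha2Of hconc hT θ
  have upper : ∀ T : LargeDeviation.Estimator,
      LargeDeviation.alpha2Of (LargeDeviation.shiftFamily f) LargeDeviation.gLog T θ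
        ≤ LargeDeviation.alpha1 (LargeDeviation.shiftFamily f) LargeDeviation.gLog θ :=
    fun T => LargeDeviation.alpha2Of_le_alpha1 _ T θ
  have h1 := hf.alpha1_le hconc θ
  obtain ⟨T, hT⟩ := hf.exists_isMLE hconc
  exact ⟨LargeDeviation.isScalingExponent_gLog, hf.renyiConvergesUniformly hconc θ,
    le_antisymm h1 ((key T hT).trans (upper T)), hf.alphaBar1_eq hconc θ,
    le_antisymm (iSup_le fun T => (upper T).trans h1)
      ((key T hT).trans (le_iSup (fun T => LargeDeviation.alpha2Of _ _ T θ) T)),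
    hf.alphaBar2_eq hconc θ, ⟨T, hT⟩,
    fun T hT => le_antisymm ((upper T).trans h1) (key T hT)⟩
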